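/- Conventions. A metric space $X$ has \emph{bounded geometry} if $\sup_{x\in X}|B(x,R)|<\infty$ for every $R>0$, where $B(x,R)$ is the closed ball; a sequence $(X_n)_{n\in\mathbb N}$ of metric spaces has \emph{uniformly bounded geometry} if $\sup_n\sup_{x\in X_n}|B(x,R)|<\infty$ for every $R>0$. A metric space $Z$ is \emph{sparse} if it has a decomposition $Z=\bigsqcup_{n\in\mathbb N}Z_n$ into non-empty finite sets with $d(Z_n,Z_m)\to\infty$ as $n+m\to\infty$, $n\neq m$; any subset of a metric space carries the restricted metric. A sparse space $Z$ \emph{consists of ghostly measured asymptotic expanders} if there are such a decomposition and probability measures $m_n$ on $Z_n$ with $\lim_{n\to\infty}\sup_{x\in Z_n}m_n(\{x\})=0$ such that for every $\alpha\in(0,\tfrac12]$ there exist $c_\alpha\in(0,1)$ and $R_\alpha>0$ with $m_n(\{x\in Z_n\setminus A: d(x,A)\le R_\alpha\})>c_\alpha\, m_n(A)$ for all $n$ and all $A\subseteq Z_n$ with $\alpha\le m_n(A)\le\tfrac12$; it does so \emph{with uniformly bounded geometry} if moreover the sequence $(Z_n)_n$ has uniformly bounded geometry. A map $f:X\to Y$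 is a \emph{coarse embedding} if there are non-decreasing unbounded functions $\rho_\pm:[0,\infty)\to[0,\infty)$ with $\rho_-(d(x,y))\le d(f(x),f(y))\le\rho_+(d(x,y))$ for all $x,y\in X$; then $Y$ \emph{coarsely contains} $X$. The spaces $X$ and $Y$ are \emph{coarsely equivalent} if there is a coarse embedding $f:X\to Y$ such that, for some $C>0$, every point of $Y$ is within distance $C$ of $f(X)$. Let $\mathcal H_0$ be an infinite-dimensional separable complex Hilbert space. A bounded operator $T$ on $\ell^2(X;\mathcal H_0)$ or on $\ell^2(X)=\ell^2(X;\mathbb C)$ has matrix entries $T_{x,y}\xi=(T(\delta_y\otimes\xi))(x)$; it has \emph{finite propagation} if $\sup\{d(x,y):T_{x,y}\ne0\}<\infty$ and is \emph{locally compact} if all $T_{x,y}$ are compact. The \emph{Roe algebra} $C^*(X)$ is the norm closure of the locally compact finite propagation operators on $\ell^2(X;\mathcal H_0)$, and the \emph{uniform Roe algebra} $C^*_u(X)$ is the norm closure of the finite propagation operators on $\ell^2(X)$. For a sparse space $Z$ and $\mathcal H\in\{\mathcal H_0,\mathbb C\}$, a \emph{block-rank-one ghost projection} is a projection $P=\bigoplus_n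 P_n$ on $\ell^2(Z;\mathcal H)=\bigoplus_n\ell^2(Z_n;\mathcal H)$, for some decomposition $Z=\bigsqcup_n Z_n$ as above, where each $P_n$ is a rank-one projection, say onto the line spanned by the unit vector $\xi_n$, and the associated probability measures $m_n(\{x\})=\|P_n\delta_x\|^2=\|\xi_n(x)\|^2$ satisfy $\lim_{n\to\infty}\sup_{x\in Z_n}m_n(\{x\})=0$. Theorem. Let $X$ be a metric space with bounded geometry. Then the following are equivalent: \begin{enumerate} \item for every sparse subspace $X'\subseteq X$, the Roe algebra $C^*(X')$ contains no block-rank-one ghost projection; \item for every sparse subspace $X'\subseteq X$, the uniform Roe algebra $C^*_u(X')$ contains no block-rank-one ghost projection; \item $X$ contains no sparse subspace consisting of ghostly measured asymptotic expanders; \item $X$ coarsely contains no sparse space consisting of ghostly measured asymptotic expanders with uniformly bounded geometry. \end{enumerate} Moreover, each of these properties is coarsely invariant among metric spaces with bounded geometry: if $X$ and $Y$ have bounded geometry and are coarsely equivalent, then $X$ has the property if and only if $Y$ does. -/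

import Mathlib

open Filter Topology
open scoped NNReal ENNReal

universe u v w t

namespace RoeRigidity

noncomputable section

/-! ### Coarse geometry -/

/-- `X` has bounded geometry: for every `R > 0` the cardinalities of the closed balls of radius `R`
are finite and uniformly bounded. -/
def BoundedGeometry (X : Type u) [MetricSpace X] : Prop :=
  ∀ R : ℝ, 0 < R → ∃ N : ℕ, ∀ x : X, (Metric.closedBall x R).encard ≤ N

/-- A sequence of metric spaces has uniformly bounded geometry: for every `R > 0` the closed balls
of radius `R` in all members of the sequence have uniformly bounded finite cardinality. -/
def UniformlyBoundedGeometry (V : ℕ → Type u) [∀ n, MetricSpace (V n)] : Prop :=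
  ∀ R : ℝ, 0 < R → ∃ N : ℕ, ∀ (n : ℕ) (x : V n), (Metric.closedBall x R).encard ≤ N

/-- `f` is a coarse embedding: there are non-decreasing unbounded control functions
`ρ₋, ρ₊ : [0, ∞) → [0, ∞)` with `ρ₋ (d x y) ≤ d (f x) (f y) ≤ ρ₊ (d x y)`. -/
def IsCoarseEmbedding {X : Type u} {Y : Type v} [MetricSpace X] [MetricSpace Y] (f : X → Y) :
    Prop :=
  ∃ ρ₁ ρ₂ : ℝ≥0 → ℝ≥0,
    Monotone ρ₁ ∧ ¬ BddAbove (Set.range ρ₁) ∧ Monotone ρ₂ ∧ ¬ BddAbove (Set.range ρ₂) ∧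
    ∀ x y : X, ρ₁ (nndist x y) ≤ nndist (f x) (f y) ∧ nndist (f x) (f y) ≤ ρ₂ (nndist x y)

/-- `X` and `Y` are coarsely equivalent: there is a coarse embedding of `X` into `Y` whose image
is within bounded distance of every point of `Y`. -/
def CoarselyEquivalent (X : Type u) (Y : Type v) [MetricSpace X] [MetricSpace Y] : Prop :=
  ∃ f : X → Y, IsCoarseEmbedding f ∧ ∃ C : ℝ, 0 < C ∧ ∀ y : Y, ∃ x : X, dist y (f x) ≤ C

/-- A decomposition `Z = ⨆ Zₙ` of a metric space into a sequence of pairwise disjoint, non-empty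
finite sets with `d (Zₙ, Zₘ) → ∞` as `n + m → ∞`, `n ≠ m`. -/
structure SparseDecomposition (Z : Type u) [MetricSpace Z] where
  /-- the pieces of the decomposition -/
  block : ℕ → Finset Z
  block_nonempty : ∀ n, (block n).Nonempty
  block_disjoint : ∀ n m, n ≠ m → Disjoint (block n) (block m)
  block_cover : ∀ z : Z, ∃ n, z ∈ block n
  block_separated : ∀ R : ℝ, ∃ N : ℕ, ∀ n m : ℕ, n ≠ m → N ≤ n + m →
    ∀ x ∈ block n, ∀ y ∈ block m, R ≤ dist x y

/-- A metric space is sparse if it admits a decomposition as above. -/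
def IsSparse (Z : Type u) [MetricSpace Z] : Prop := Nonempty (SparseDecomposition Z)

/-! ### Measured asymptotic expanders

A probability measure on a finite set `V` is given by its weight function, an element of
`stdSimplex ℝ V`; the measure of `A ⊆ V` is `∑ x ∈ A, m x`. -/

open Classical in
/-- The outer `R`-boundary `{x ∉ A : d (x, A) ≤ R}` of a subset `A` of a finite metric space. -/
def outerBoundary {V : Type u} [MetricSpace V] [Fintype V] (R : ℝ) (A : Finset V) : Finset V :=
  Finset.univ.filter fun x => x ∉ A ∧ ∃ a ∈ A, dist x a ≤ R

/-- A sequence of finite metric spaces with probability measures is a sequence of measured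
asymptotic expanders. -/
def MeasuredAsymptoticExpanders (V : ℕ → Type u) [∀ n, MetricSpace (V n)] [∀ n, Fintype (V n)]
    (m : ∀ n, V n → ℝ) : Prop :=
  ∀ α : ℝ, 0 < α → α ≤ 1 / 2 →
    ∃ c : ℝ, 0 < c ∧ c < 1 ∧ ∃ R : ℝ, 0 < R ∧
      ∀ (n : ℕ) (A : Finset (V n)), α ≤ ∑ x ∈ A, m n x → ∑ x ∈ A, m n x ≤ 1 / 2 →
        c * ∑ x ∈ A, m n x < ∑ x ∈ outerBoundary R A, m n x

/-- A sequence of (probability) measures is ghostly: the largest point mass of `m n` tends to `0`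
as `n → ∞`. -/
def Ghostly (V : ℕ → Type u) (m : ∀ n, V n → ℝ) : Prop :=
  Tendsto (fun n => ⨆ x : V n, m n x) atTop (𝓝 0)

/-- The pieces of the decomposition `D` carry probability measures with which they form a ghostly
sequence of measured asymptotic expanders. -/
def SparseDecomposition.IsGhostlyMAE {Z : Type u} [MetricSpace Z] (D : SparseDecomposition Z) :
    Prop :=
  ∃ m : ∀ n, D.block n → ℝ, (∀ n, m n ∈ stdSimplex ℝ (D.block n)) ∧
    Ghostly (fun n => D.block n) m ∧ MeasuredAsymptoticExpanders (fun n => D.block n) m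

/-- The sparse space `Z` consists of ghostly measured asymptotic expanders. -/
def ConsistsOfGhostlyMAE (Z : Type u) [MetricSpace Z] : Prop :=
  ∃ D : SparseDecomposition Z, D.IsGhostlyMAE

/-- The sparse space `Z` consists of ghostly measured asymptotic expanders with uniformly bounded
geometry. -/
def ConsistsOfGhostlyMAEWithUBG (Z : Type u) [MetricSpace Z] : Prop :=
  ∃ D : SparseDecomposition Z, D.IsGhostlyMAE ∧ UniformlyBoundedGeometry fun n => D.block n

/-! ### Roe algebras -/

section Operators

variable (H : Type w) [NormedAddCommGroup H] [InnerProductSpace ℂ H]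

/-- The space `ℓ²(X; H)`. -/
abbrev L2 (X : Type u) : Type (max u w) := lp (fun _ : X => H) 2

open Classical in
/-- The isometric inclusion `H → ℓ²(X; H)`, `ξ ↦ δ_x ⊗ ξ`. -/
def delta {X : Type u} (x : X) : H →L[ℂ] L2 H X :=
  lp.singleContinuousLinearMap ℂ (fun _ : X => H) 2 x

variable {H}

/-- The matrix entry `T_{x,y}`, given by `T_{x,y} ξ = (T (δ_y ⊗ ξ)) (x)`. -/
def entry {X : Type u} (T : L2 H X →L[ℂ] L2 H X) (x y : X) : H →L[ℂ] H :=
  (lp.evalCLM ℂ (fun _ : X => H) 2 x).comp (T.comp (delta H y))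

/-- `T` has finite propagation. -/
def FinitePropagation {X : Type u} [MetricSpace X] (T : L2 H X →L[ℂ] L2 H X) : Prop :=
  ∃ R : ℝ, ∀ x y : X, entry T x y ≠ 0 → dist x y ≤ R

/-- `T` is locally compact. -/
def LocallyCompactOp {X : Type u} (T : L2 H X →L[ℂ] L2 H X) : Prop :=
  ∀ x y : X, IsCompactOperator (entry T x y)

variable (H) in
/-- The Roe algebra `C*(X)`: the norm closure of the locally compact operators of finite
propagation on `ℓ²(X; H)` (with `H` separable and infinite-dimensional). -/
def roeAlgebra (X : Type u) [MetricSpace X] : Set (L2 H X →L[ℂ] L2 H X) :=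
  closure {T | FinitePropagation T ∧ LocallyCompactOp T}

/-- The uniform Roe algebra `C*_u(X)`: the norm closure of the operators of finite propagation on
`ℓ²(X) = ℓ²(X; ℂ)`. -/
def uniformRoeAlgebra (X : Type u) [MetricSpace X] : Set (L2 ℂ X →L[ℂ] L2 ℂ X) :=
  closure {T | FinitePropagation T}

/-! ### Block-rank-one projections -/

variable {Z : Type u} [MetricSpace Z]

/-- `P` is a projection of the form `⨁ Pₙ` on `⨁ ℓ²(Zₙ; H) = ℓ²(Z; H)` where each `Pₙ` is a rank-one
projection on `ℓ²(Zₙ; H)`. -/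
def IsBlockRankOneProjection [CompleteSpace H] (D : SparseDecomposition Z)
    (P : L2 H Z →L[ℂ] L2 H Z) : Prop :=
  IsStarProjection P ∧
  ∃ Q : ∀ n, PiLp 2 (fun _ : D.block n => H) →L[ℂ] PiLp 2 (fun _ : D.block n => H),
    (∀ n, IsStarProjection (Q n) ∧ Module.finrank ℂ (LinearMap.range (Q n).toLinearMap) = 1) ∧
    ∀ (f : L2 H Z) (n : ℕ) (x : D.block n),
      P f (x : Z) = Q n (WithLp.toLp 2 fun y : D.block n => f (y : Z)) x

/-- The measures `mₙ` on `Zₙ` associated to a block-rank-one projection `P = ⨁ Pₙ`: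
`mₙ x = ‖Pₙ δ_x‖²`, where `δ_x` acts by `ξ ↦ δ_x ⊗ ξ`, so that `mₙ x = ‖ξₙ x‖²` when `Pₙ` is the
projection onto the line spanned by the unit vector `ξₙ`. -/
def associatedMeasure (D : SparseDecomposition Z) (P : L2 H Z →L[ℂ] L2 H Z) (n : ℕ)
    (x : D.block n) : ℝ :=
  ‖P.comp (delta H (x : Z))‖ ^ 2

/-- `P` is a block-rank-one ghost projection on `ℓ²(Z; H)`: it is block-rank-one with respect to
some decomposition of `Z` as a sparse space, and the associated measures are ghostly. -/
def IsBlockRankOneGhostProjection [CompleteSpace H] (P : L2 H Z →L[ℂ] L2 H Z) : Prop :=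
  ∃ D : SparseDecomposition Z, IsBlockRankOneProjection D P ∧
    Ghostly (fun n => D.block n) (associatedMeasure D P)

end Operators

/-! ### The four properties -/

/-- All sparse subspaces of `X` contain no block-rank-one ghost projections in their Roe
algebras (formed with the Hilbert space `H`). -/
def NoGhostInRoeAlgebras (H : Type w) [NormedAddCommGroup H] [InnerProductSpace ℂ H]
    [CompleteSpace H] (X : Type u) [MetricSpace X] : Prop :=
  ∀ S : Set X, IsSparse S → ∀ P ∈ roeAlgebra H S, ¬ IsBlockRankOneGhostProjection P

/-- All sparse subspaces of `X` contain no block-rank-one ghost projections in their uniform Roe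
algebras. -/
def NoGhostInUniformRoeAlgebras (X : Type u) [MetricSpace X] : Prop :=
  ∀ S : Set X, IsSparse S → ∀ P ∈ uniformRoeAlgebra S, ¬ IsBlockRankOneGhostProjection P

/-- `X` contains no sparse subspaces consisting of ghostly measured asymptotic expanders. -/
def ContainsNoGhostlyMAE (X : Type u) [MetricSpace X] : Prop :=
  ∀ S : Set X, ¬ ConsistsOfGhostlyMAE S

/-- `X` coarsely contains no sparse spaces consisting of ghostly measured asymptotic expanders with
uniformly bounded geometry. The sparse spaces range over an arbitrary universe `v`. -/
def CoarselyContainsNoGhostlyMAE.{u', v'} (X : Type u') [MetricSpace X] : Prop :=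
  ∀ (Z : Type v') [MetricSpace Z], ConsistsOfGhostlyMAEWithUBG Z →
    ¬ ∃ f : Z → X, IsCoarseEmbedding f

end

end RoeRigidity

namespace RoeRigidity

/-! ### Coarse embeddings: composition, control functions, quasi-inverses -/

section CoarseMaps

variable {X : Type u} {Y : Type v} {Z : Type w} [MetricSpace X] [MetricSpace Y] [MetricSpace Z]

/-! Properties (1), (2) and (4) are each compared with (3), by passing between ghost projections and
expanders.

From projections to expanders (`consistsOfGhostlyMAE_of_ghostProjection`): let `P = ⨁ |ξₙ⟩⟨ξₙ|` be
close to an operator `T` of propagation `R`, and suppose some `A` in a block has small `R`-boundary.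
Cut `ξₙ` down to the set `B` of points farther than `R` from `A`. Then `T` sends this vector to
something vanishing on `A`, while `P` produces `μ(B) ξₙ` there, which contradicts closeness. Only
propagation enters, so both Roe algebras are covered at once.

From expanders to projections (`exists_ghostProjection_mem_roeAlgebra`): `P` projects blockwise onto
the vectors with entries `√(mₙ x)`. The expansion constants depend on the lower bound `α` for the
measure of the set, and expansion is phrased through boundary masses rather than edges, so there is
no spectral gap on the whole block. Weighting the edges by `min (m x) (m y)` repairs the second
point (`lt_edgeCut_minWeight`). For the first, removing a maximal badly expanding set leaves `Y` of
measure at least `1 - α` that expands at all scales (`exists_expanding_subset`). Cheeger's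
inequality then gives the lazy random walk on `Y` a spectral gap (`norm_walkMatrix_pow_sub_le`): its
powers, which have finite propagation, converge in norm to the averaging projection of `Y`, and this
is within `O(√α)` of that of the block. All constants depend only on `α`, the expansion data and the
size of balls, hence not on `n`.

For (3) and (4), measures are pushed forward along a coarse embedding after dropping finitely many
blocks (`exists_consistsOfGhostlyMAE_of_isCoarseEmbedding`). Property (4) pulls back along coarse
embeddings, and a coarse equivalence supplies embeddings both ways, so all four properties are
coarsely invariant. -/

lemma exists_le_of_not_bddAbove_range {ρ : ℝ≥0 → ℝ≥0} (h : ¬ BddAbove (Set.range ρ)) (r : ℝ≥0) :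
    ∃ s, r < ρ s := by
  by_contra! hcon
  exact h ⟨r, by rintro _ ⟨s, rfl⟩; exact hcon s⟩

lemma not_bddAbove_range_comp {ρ σ : ℝ≥0 → ℝ≥0} (hρm : Monotone ρ) (hρ : ¬ BddAbove (Set.range ρ))
    (hσ : ¬ BddAbove (Set.range σ)) : ¬ BddAbove (Set.range (ρ ∘ σ)) := by
  rintro ⟨r, hr⟩
  obtain ⟨s, hs⟩ := exists_le_of_not_bddAbove_range hρ r
  obtain ⟨t, ht⟩ := exists_le_of_not_bddAbove_range hσ s
  exact absurd (hr ⟨t, rfl⟩) (not_le.2 (hs.trans_le (hρm ht.le)))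

lemma IsCoarseEmbedding.comp {g : Y → Z} {f : X → Y} (hg : IsCoarseEmbedding g)
    (hf : IsCoarseEmbedding f) : IsCoarseEmbedding (g ∘ f) := by
  obtain ⟨ρ₁, ρ₂, m1, u1, m2, u2, h⟩ := hg
  obtain ⟨σ₁, σ₂, m3, u3, m4, u4, k⟩ := hf
  exact ⟨ρ₁ ∘ σ₁, ρ₂ ∘ σ₂, m1.comp m3, not_bddAbove_range_comp m1 u1 u3, m2.comp m4,
    not_bddAbove_range_comp m2 u2 u4, fun x y =>
      ⟨(m1 (k x y).1).trans (h _ _).1, (h _ _).2.trans (m2 (k x y).2)⟩⟩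

lemma IsCoarseEmbedding.of_isometry {f : X → Y} (hf : Isometry f) : IsCoarseEmbedding f := by
  have : ¬ BddAbove (Set.range (id : ℝ≥0 → ℝ≥0)) := by
    rw [Set.range_id]
    exact not_bddAbove_univ
  exact ⟨id, id, monotone_id, this, monotone_id, this, fun x y => by simp [hf.nndist_eq]⟩

/-- A map is a coarse embedding as soon as distances downstairs and upstairs control each other. -/
lemma IsCoarseEmbedding.of_forall_exists {f : X → Y}
    (h₁ : ∀ r : ℝ≥0, ∃ s : ℝ≥0, ∀ x y, nndist (f x) (f y) ≤ r → nndist x y ≤ s)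
    (h₂ : ∀ r : ℝ≥0, ∃ s : ℝ≥0, ∀ x y, nndist x y ≤ r → nndist (f x) (f y) ≤ s) :
    IsCoarseEmbedding f := by
  have hbdd : ∀ r : ℝ≥0,
      BddAbove {t : ℝ≥0 | ∃ x y, nndist x y ≤ r ∧ nndist (f x) (f y) = t} := fun r => by
    obtain ⟨s, hs⟩ := h₂ r
    exact ⟨s, by rintro _ ⟨x, y, hxy, rfl⟩; exact hs x y hxy⟩
  -- The summand `r` makes `ρ₂` unbounded even when the image of `f` is bounded.
  set ρ₂ : ℝ≥0 → ℝ≥0 := fun r =>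
    r + sSup {t : ℝ≥0 | ∃ x y, nndist x y ≤ r ∧ nndist (f x) (f y) = t} with hρ₂
  have hbelow : ∀ r : ℝ≥0, BddBelow {t : ℝ≥0 | t = r ∨ ∃ x y, r ≤ nndist x y ∧ nndist (f x) (f y) = t} :=
    fun r => OrderBot.bddBelow _
  -- Adjoining the value `r` keeps the set nonempty when no two points are `r` apart; otherwise
  -- `sInf ∅ = 0` would spoil monotonicity and unboundedness.
  set ρ₁ : ℝ≥0 → ℝ≥0 := fun r =>
    sInf {t : ℝ≥0 | t = r ∨ ∃ x y, r ≤ nndist x y ∧ nndist (f x) (f y) = t} with hρ₁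
  have hne : ∀ r : ℝ≥0,
      {t : ℝ≥0 | t = r ∨ ∃ x y, r ≤ nndist x y ∧ nndist (f x) (f y) = t}.Nonempty :=
    fun r => ⟨r, Or.inl rfl⟩
  refine ⟨ρ₁, ρ₂, ?_, ?_, ?_, ?_, fun x y => ⟨?_, ?_⟩⟩
  · intro r s hrs
    refine le_csInf (hne s) ?_
    rintro t (rfl | ⟨x, y, hxy, rfl⟩)
    · exact (csInf_le (hbelow r) (Or.inl rfl)).trans hrs
    · exact csInf_le (hbelow r) (Or.inr ⟨x, y, hrs.trans hxy, rfl⟩)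
  · rintro ⟨b, hb⟩
    obtain ⟨s, hs⟩ := h₁ (b + 1)
    have h : b + 1 ≤ ρ₁ (max (s + 1) (b + 1)) := by
      refine le_csInf (hne _) ?_
      rintro t (rfl | ⟨x, y, hxy, rfl⟩)
      · exact le_max_right _ _
      · by_contra hcon
        have h1 := (hs x y (not_le.1 hcon).le)
        have h2 := (le_max_left (s + 1) (b + 1)).trans (hxy.trans h1)
        exact absurd h2 (not_le.2 (lt_add_one s))
    exact absurd (h.trans (hb ⟨_, rfl⟩)) (not_le.2 (lt_add_one b))
  · intro r s hrs
    refine add_le_add hrs ?_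
    refine csSup_le' ?_
    rintro t ⟨x, y, hxy, rfl⟩
    exact le_csSup (hbdd s) ⟨x, y, hxy.trans hrs, rfl⟩
  · rintro ⟨b, hb⟩
    have : b + 1 ≤ ρ₂ (b + 1) := le_self_add
    exact absurd (this.trans (hb ⟨_, rfl⟩)) (not_le.2 (lt_add_one b))
  · exact csInf_le (hbelow _) (Or.inr ⟨x, y, le_rfl, rfl⟩)
  · exact (le_csSup (hbdd _) ⟨x, y, le_rfl, rfl⟩).trans le_add_self

lemma IsCoarseEmbedding.exists_nndist_le {f : X → Y} (hf : IsCoarseEmbedding f) (r : ℝ≥0) :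
    ∃ s : ℝ≥0, ∀ x y, nndist (f x) (f y) ≤ r → nndist x y ≤ s := by
  obtain ⟨ρ₁, ρ₂, m1, u1, -, -, h⟩ := hf
  obtain ⟨s, hs⟩ := exists_le_of_not_bddAbove_range u1 r
  refine ⟨s, fun x y hxy => le_of_not_ge fun hlt => ?_⟩
  exact absurd ((m1 hlt).trans ((h x y).1.trans hxy)) (not_le.2 hs)

lemma IsCoarseEmbedding.exists_nndist_map_le {f : X → Y} (hf : IsCoarseEmbedding f) (r : ℝ≥0) :
    ∃ s : ℝ≥0, ∀ x y, nndist x y ≤ r → nndist (f x) (f y) ≤ s := by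
  obtain ⟨ρ₁, ρ₂, -, -, m2, -, h⟩ := hf
  exact ⟨ρ₂ r, fun x y hxy => (h x y).2.trans (m2 hxy)⟩

/-- Any choice of `g y` with `f (g y)` within `C` of `y` works: distances between `y`'s and between
`f (g y)`'s differ by at most `2C`, and `f` is controlled in both directions. -/
lemma CoarselyEquivalent.exists_isCoarseEmbedding_symm (h : CoarselyEquivalent X Y) :
    ∃ g : Y → X, IsCoarseEmbedding g := by
  obtain ⟨f, hf, C, hC, hfC⟩ := h
  choose g hg using hfC
  set c : ℝ≥0 := ⟨C, hC.le⟩ with hc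
  have hg' : ∀ y, nndist y (f (g y)) ≤ c := fun y => hg y
  refine ⟨g, IsCoarseEmbedding.of_forall_exists (fun r => ?_) fun r => ?_⟩
  · obtain ⟨s, hs⟩ := hf.exists_nndist_map_le r
    refine ⟨c + s + c, fun y z hyz => ?_⟩
    calc nndist y z ≤ nndist y (f (g y)) + nndist (f (g y)) (f (g z)) + nndist (f (g z)) z :=
          (nndist_triangle _ _ _).trans (by gcongr; exact nndist_triangle _ _ _)
      _ ≤ c + s + c := by
          gcongr
          · exact hg' y
          · exact hs _ _ hyz
          · rw [nndist_comm]; exact hg' z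
  · obtain ⟨s, hs⟩ := hf.exists_nndist_le (c + r + c)
    refine ⟨s, fun y z hyz => hs _ _ ?_⟩
    calc nndist (f (g y)) (f (g z)) ≤ nndist (f (g y)) y + nndist y z + nndist z (f (g z)) :=
          (nndist_triangle _ _ _).trans (by gcongr; exact nndist_triangle _ _ _)
      _ ≤ c + r + c := by
          gcongr
          · rw [nndist_comm]; exact hg' y
          · exact hg' z

lemma CoarselyContainsNoGhostlyMAE.of_isCoarseEmbedding {f : X → Y} (hf : IsCoarseEmbedding f)
    (h : CoarselyContainsNoGhostlyMAE.{v, t} Y) : CoarselyContainsNoGhostlyMAE.{u, t} X :=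
  fun W _ hW ⟨g, hg⟩ => h W hW ⟨f ∘ g, hf.comp hg⟩

end CoarseMaps

/-! ### Bounded geometry and countability of sparse subspaces -/

section Subspaces

lemma BoundedGeometry.of_isometry {X : Type u} {Y : Type v} [MetricSpace X] [MetricSpace Y]
    (hY : BoundedGeometry Y) {f : X → Y} (hf : Isometry f) : BoundedGeometry X := by
  intro R hR
  obtain ⟨N, hN⟩ := hY R hR
  refine ⟨N, fun x => le_trans ?_ (hN (f x))⟩
  rw [← hf.injective.encard_image]
  refine Set.encard_le_encard ?_
  rintro _ ⟨y, hy, rfl⟩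
  rwa [Metric.mem_closedBall, hf.dist_eq]

lemma BoundedGeometry.uniformlyBoundedGeometry {Z : Type u} [MetricSpace Z] (hZ : BoundedGeometry Z)
    (D : SparseDecomposition Z) : UniformlyBoundedGeometry fun n => D.block n := by
  intro R hR
  obtain ⟨N, hN⟩ := hZ R hR
  refine ⟨N, fun n x => le_trans ?_ (hN x)⟩
  rw [← Subtype.val_injective.encard_image]
  refine Set.encard_le_encard ?_
  rintro _ ⟨y, hy, rfl⟩
  exact hy

lemma SparseDecomposition.countable {Z : Type u} [MetricSpace Z] (D : SparseDecomposition Z) :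
    Countable Z := by
  have : (⋃ n, (D.block n : Set Z)) = Set.univ := Set.eq_univ_of_forall fun z =>
    Set.mem_iUnion.2 (by simpa using D.block_cover z)
  rw [← Set.countable_univ_iff, ← this]
  exact Set.countable_iUnion fun n => (D.block n).countable_toSet

end Subspaces

/-! ### Pushing measured asymptotic expanders forward along coarse embeddings -/

section Pushforward

variable {V : Type u} {W : Type v} [Fintype V]

open Classical in
/-- The image of a measure under a map of finite sets. -/
noncomputable def pushMeasure (φ : V → W) (m : V → ℝ) (y : W) : ℝ := ∑ x with φ x = y, m x

open Classical in
lemma sum_pushMeasure (φ : V → W) (m : V → ℝ) (A : Finset W) :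
    ∑ y ∈ A, pushMeasure φ m y = ∑ x with φ x ∈ A, m x := by
  unfold pushMeasure
  rw [← Finset.sum_fiberwise_of_maps_to (s := Finset.univ.filter fun x => φ x ∈ A) (t := A) (g := φ)
    (fun x hx => (Finset.mem_filter.1 hx).2)]
  refine Finset.sum_congr rfl fun y hy => Finset.sum_congr ?_ fun _ _ => rfl
  ext x
  simp only [Finset.mem_filter, Finset.mem_univ, true_and]
  exact ⟨fun h => ⟨h ▸ hy, h⟩, fun h => h.2⟩

lemma pushMeasure_mem_stdSimplex [Fintype W] (φ : V → W) (m : V → ℝ) (hm : m ∈ stdSimplex ℝ V) :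
    pushMeasure φ m ∈ stdSimplex ℝ W := by
  classical
  refine ⟨fun y => Finset.sum_nonneg fun x _ => hm.1 x, ?_⟩
  rw [sum_pushMeasure, ← hm.2]
  simp

/-- If a sparse space consisting of ghostly measured asymptotic expanders with uniformly bounded
geometry embeds coarsely into `X`, then the image of all but finitely many of its blocks is a sparse
subspace of `X` consisting of ghostly measured asymptotic expanders. -/
theorem exists_consistsOfGhostlyMAE_of_isCoarseEmbedding {X : Type u} {Z : Type v} [MetricSpace X]
    [MetricSpace Z] {f : Z → X} (hf : IsCoarseEmbedding f) (hZ : ConsistsOfGhostlyMAEWithUBG Z) :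
    ∃ S : Set X, ConsistsOfGhostlyMAE S := by
  classical
  obtain ⟨D, ⟨m, hm, hghost, hmae⟩, hubg⟩ := hZ
  have hlow : ∀ R : ℝ, ∃ r : ℝ, ∀ x y, dist (f x) (f y) < R → dist x y < r := fun R => by
    obtain ⟨s, hs⟩ := hf.exists_nndist_le R.toNNReal
    refine ⟨s + 1, fun x y hxy => lt_of_le_of_lt ?_ (lt_add_one _)⟩
    have : nndist (f x) (f y) ≤ R.toNNReal := by
      rw [← NNReal.coe_le_coe, coe_nndist]
      exact hxy.le.trans (Real.le_coe_toNNReal R)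
    exact hs x y this
  -- Points at distance at least `r` have distinct images. Beyond index `N` the blocks are
  -- `r`-separated, so their images are disjoint; the first `N` blocks are discarded.
  obtain ⟨r, hr⟩ := hlow 1
  obtain ⟨N, hN⟩ := D.block_separated r
  set S : Set X := {y | ∃ n, ∃ z ∈ D.block (N + n), f z = y} with hS
  let φ : ∀ n, D.block (N + n) → S := fun n z => ⟨f z, n, z, z.2, rfl⟩
  let B : ℕ → Finset S := fun n => Finset.univ.image (φ n)
  have mem_B : ∀ n (y : S), y ∈ B n ↔ ∃ z ∈ D.block (N + n), f z = y := fun n y => by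
    simp only [B, Finset.mem_image, Finset.mem_univ, true_and]
    constructor
    · rintro ⟨z, rfl⟩; exact ⟨z, z.2, rfl⟩
    · rintro ⟨z, hz, h⟩; exact ⟨⟨z, hz⟩, Subtype.ext h⟩
  let D' : SparseDecomposition S :=
    { block := B
      block_nonempty := fun n => by
        obtain ⟨z, hz⟩ := D.block_nonempty (N + n)
        exact ⟨φ n ⟨z, hz⟩, Finset.mem_image_of_mem _ (Finset.mem_univ _)⟩
      block_disjoint := fun n k hnk => Finset.disjoint_left.2 fun y hy hy' => by
        obtain ⟨z, hz, h1⟩ := (mem_B n y).1 hy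
        obtain ⟨z', hz', h2⟩ := (mem_B k y).1 hy'
        refine absurd (hN (N + n) (N + k) (by omega) (by omega) z hz z' hz') (not_le.2 (hr _ _ ?_))
        rw [h1, h2, dist_self]
        exact one_pos
      block_cover := fun y => by
        obtain ⟨n, z, hz, h⟩ := y.2
        exact ⟨n, (mem_B n y).2 ⟨z, hz, h⟩⟩
      block_separated := fun R => by
        obtain ⟨s, hs⟩ := hlow R
        obtain ⟨N', hN'⟩ := D.block_separated s
        refine ⟨N', fun n k hnk hle y hy y' hy' => ?_⟩
        obtain ⟨z, hz, h1⟩ := (mem_B n y).1 hy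
        obtain ⟨z', hz', h2⟩ := (mem_B k y').1 hy'
        by_contra hcon
        rw [Subtype.dist_eq, ← h1, ← h2, not_le] at hcon
        exact absurd (hN' (N + n) (N + k) (by omega) (by omega) z hz z' hz')
          (not_le.2 (hs _ _ hcon)) }
  let ψ : ∀ n, D.block (N + n) → D'.block n := fun n z =>
    ⟨φ n z, Finset.mem_image_of_mem _ (Finset.mem_univ _)⟩
  have hψ : ∀ n x y, dist (ψ n x) (ψ n y) = dist (f x) (f y) := fun n x y => rfl
  refine ⟨S, D', fun n => pushMeasure (ψ n) (m (N + n)), fun n =>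
    pushMeasure_mem_stdSimplex _ _ (hm _), ?_, fun α hα hα2 => ?_⟩
  -- Each fibre of `ψ n` lies in a ball of radius `max r 1`, hence has at most `K` points, and the
  -- largest point mass grows by at most the factor `K`.
  · obtain ⟨K, hK⟩ := hubg (max r 1) (by positivity)
    have hshift : Tendsto (fun n => K * ⨆ x : D.block (N + n), m (N + n) x) atTop (𝓝 0) := by
      have h1 : Tendsto (fun n => N + n) atTop atTop := tendsto_add_atTop_nat N |>.congr
        fun n => add_comm n N
      simpa using (hghost.comp h1).const_mul (K : ℝ)
    refine squeeze_zero (fun n => Real.iSup_nonneg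
      (pushMeasure_mem_stdSimplex _ _ (hm _)).1) (fun n => ?_) hshift
    have hsup0 : 0 ≤ ⨆ x : D.block (N + n), m (N + n) x := Real.iSup_nonneg (hm _).1
    refine Real.iSup_le (fun y => ?_) (by positivity)
    obtain ⟨z, hz⟩ : ∃ z, ψ n z = y := by
      obtain ⟨z, -, h⟩ := Finset.mem_image.1 y.2
      exact ⟨z, Subtype.ext h⟩
    refine (Finset.sum_le_card_nsmul _ _ (⨆ x : D.block (N + n), m (N + n) x) fun x _ =>
      le_ciSup (Set.finite_range _).bddAbove x).trans ?_
    rw [nsmul_eq_mul]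
    refine mul_le_mul_of_nonneg_right ?_ hsup0
    have h2 := hK (N + n) z
    have h3 : ((Finset.univ.filter fun x => ψ n x = y : Finset _) : Set (D.block (N + n)))
        ⊆ Metric.closedBall z (max r 1) := fun x hx => by
      have hx' : ψ n x = ψ n z := by simpa [hz] using hx
      rw [Metric.mem_closedBall]
      refine le_trans (hr _ _ ?_).le (le_max_left _ _)
      rw [← hψ, hx', dist_self]
      exact one_pos
    have h4 := (Set.encard_le_encard h3).trans h2
    rw [Set.encard_coe_eq_coe_finsetCard] at h4
    convert (Nat.cast_le (α := ℝ)).2 (Nat.cast_le.1 h4) using 4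
  · obtain ⟨c, hc, hc1, R, hR, hA⟩ := hmae α hα hα2
    obtain ⟨s, hs⟩ := hf.exists_nndist_map_le R.toNNReal
    -- Preimages keep their measure, and the boundary of the preimage of `A` maps into the boundary
    -- of `A`, so `c` survives. The `+ 1` only makes the radius positive.
    refine ⟨c, hc, hc1, s + 1, by positivity, fun n A h1 h2 => ?_⟩
    rw [sum_pushMeasure] at h1 h2 ⊢
    rw [sum_pushMeasure]
    refine (hA _ _ h1 h2).trans_le (Finset.sum_le_sum_of_subset_of_nonneg (fun x hx => ?_)
      fun x _ _ => (hm _).1 x)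
    simp only [outerBoundary, Finset.mem_filter, Finset.mem_univ, true_and] at hx ⊢
    obtain ⟨hxA, a, ha, hxa⟩ := hx
    refine ⟨hxA, ψ n a, ha, ?_⟩
    rw [hψ]
    have : nndist (x : Z) (a : Z) ≤ R.toNNReal := by
      rw [← NNReal.coe_le_coe, coe_nndist]
      exact hxa.trans (Real.le_coe_toNNReal R)
    exact le_trans (hs _ _ this) (by simp)

end Pushforward

/-- For spaces of bounded geometry, sparse subspaces and coarsely contained sparse spaces made of
ghostly measured asymptotic expanders are the same thing. -/
theorem containsNoGhostlyMAE_iff {X : Type u} [MetricSpace X] (hX : BoundedGeometry X) :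
    ContainsNoGhostlyMAE X ↔ CoarselyContainsNoGhostlyMAE.{u, v} X := by
  constructor
  · rintro h Z _ hZ ⟨f, hf⟩
    obtain ⟨S, hS⟩ := exists_consistsOfGhostlyMAE_of_isCoarseEmbedding hf hZ
    exact h S hS
  · rintro h S ⟨D, hD⟩
    have := D.countable
    have hS : BoundedGeometry S := hX.of_isometry isometry_subtype_coe
    -- A countable space has an isometric copy in any universe. The expander structure moves to a
    -- subspace of the copy by the pushforward theorem applied to an isometry.
    obtain ⟨T, ⟨e⟩⟩ := (Countable.toSmall.{v, u} S).equiv_small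
    let _ : MetricSpace T := MetricSpace.induced e.symm e.symm.injective inferInstance
    have hi : Isometry e.symm := Isometry.of_dist_eq fun _ _ => rfl
    have hi' : Isometry e := Isometry.of_dist_eq fun x y => by
      rw [← hi.dist_eq, Equiv.symm_apply_apply, Equiv.symm_apply_apply]
    obtain ⟨S', D', hD'⟩ := exists_consistsOfGhostlyMAE_of_isCoarseEmbedding
      (IsCoarseEmbedding.of_isometry hi') ⟨D, hD, hS.uniformlyBoundedGeometry D⟩
    exact h S' ⟨D', hD', ((hS.of_isometry hi).of_isometry
      isometry_subtype_coe).uniformlyBoundedGeometry D'⟩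
      ⟨_, IsCoarseEmbedding.of_isometry
        ((isometry_subtype_coe.comp hi).comp isometry_subtype_coe)⟩

/-! ### Co-area and Cheeger inequalities for weighted graphs -/

section WeightedGraphs

variable {V : Type u}

/-- Take the least value `g z` above which lies at most half the mass. More than half lies above the
preceding value, that is, at or above `g z`, so less than half lies below. -/
lemma exists_median (m g : V → ℝ) (hm : ∀ x, 0 ≤ m x) (Y : Finset V) (hYne : Y.Nonempty) :
    ∃ s : ℝ, ∑ x ∈ Y with s < g x, m x ≤ (∑ x ∈ Y, m x) / 2 ∧
      ∑ x ∈ Y with g x < s, m x ≤ (∑ x ∈ Y, m x) / 2 := by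
  have hpos : 0 ≤ ∑ x ∈ Y, m x := Finset.sum_nonneg fun x _ => hm x
  set C := Y.filter fun z => ∑ x ∈ Y with g z < g x, m x ≤ (∑ x ∈ Y, m x) / 2 with hC
  have hCne : C.Nonempty := by
    obtain ⟨z, hz, hmax⟩ := Y.exists_max_image g hYne
    refine ⟨z, Finset.mem_filter.2 ⟨hz, ?_⟩⟩
    rw [Finset.filter_false_of_mem fun x hx => not_lt.2 (hmax x hx)]
    simpa using by linarith
  obtain ⟨z, hz, hmin⟩ := C.exists_min_image g hCne
  refine ⟨g z, (Finset.mem_filter.1 hz).2, ?_⟩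
  rcases (Y.filter fun x => g x < g z).eq_empty_or_nonempty with h0 | hne
  · rw [h0]; simpa using by linarith
  obtain ⟨y, hy, hmax⟩ := Finset.exists_max_image _ g hne
  rw [Finset.mem_filter] at hy
  have hyC : y ∉ C := fun h => absurd (hmin y h) (not_le.2 hy.2)
  have hlt : (∑ x ∈ Y, m x) / 2 < ∑ x ∈ Y with g y < g x, m x := by
    by_contra h
    exact hyC (Finset.mem_filter.2 ⟨hy.1, not_lt.1 h⟩)
  have hle : ∑ x ∈ Y with g y < g x, m x ≤ ∑ x ∈ Y with ¬ g x < g z, m x := by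
    refine Finset.sum_le_sum_of_subset_of_nonneg (fun x hx => ?_) fun x _ _ => hm x
    rw [Finset.mem_filter] at hx ⊢
    exact ⟨hx.1, fun h => absurd (hmax x (Finset.mem_filter.2 ⟨hx.1, h⟩)) (not_le.2 hx.2)⟩
  have := Finset.sum_filter_add_sum_filter_not Y (fun x => g x < g z) m
  linarith

variable [Fintype V]

/-- The summand dominates both `(f x + f y)²` and `(f x - f y)²`; the former serves Cauchy–Schwarz
in Cheeger's inequality, the latter positivity of the random walk. -/
lemma sum_weight_add_sq_le (w : V → V → ℝ) (hw : ∀ x y, w x y = w y x) (m : V → ℝ) (N : ℝ) (hN : ∀ x, ∑ y, w x y ≤ N * m x) (f : V → ℝ) :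
    ∑ x, ∑ y, w x y * (2 * f x ^ 2 + 2 * f y ^ 2) ≤ 4 * N * ∑ x, f x ^ 2 * m x := by
  have h1 : ∑ x, ∑ y, w x y * f x ^ 2 ≤ N * ∑ x, f x ^ 2 * m x := by
    rw [Finset.mul_sum]
    refine Finset.sum_le_sum fun x _ => ?_
    rw [← Finset.sum_mul]
    nlinarith [mul_le_mul_of_nonneg_right (hN x) (sq_nonneg (f x))]
  have h2 : ∑ x, ∑ y, w x y * f y ^ 2 = ∑ x, ∑ y, w x y * f x ^ 2 := by
    rw [Finset.sum_comm]
    exact Finset.sum_congr rfl fun x _ => Finset.sum_congr rfl fun y _ => by rw [hw y x]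
  calc _ = 2 * ∑ x, ∑ y, w x y * f x ^ 2 + 2 * ∑ x, ∑ y, w x y * f y ^ 2 := by
        simp only [Finset.mul_sum, ← Finset.sum_add_distrib]
        exact Finset.sum_congr rfl fun x _ => Finset.sum_congr rfl fun y _ => by ring
    _ ≤ _ := by rw [h2]; linarith

variable [DecidableEq V]

/-- The total weight of the edges leaving `A`. -/
def edgeCut (w : V → V → ℝ) (A : Finset V) : ℝ := ∑ x ∈ A, ∑ y ∈ Aᶜ, w x y

lemma edgeCut_compl (w : V → V → ℝ) (hw : ∀ x y, w x y = w y x) (A : Finset V) :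
    edgeCut w Aᶜ = edgeCut w A := by
  unfold edgeCut
  rw [compl_compl, Finset.sum_comm]
  exact Finset.sum_congr rfl fun x _ => Finset.sum_congr rfl fun y _ => hw y x

lemma edgeCut_eq_sum_indicator (w : V → V → ℝ) (A : Finset V) :
    edgeCut w A = ∑ x, ∑ y, w x y * ((if x ∈ A then 1 else 0) * (if y ∈ A then 0 else 1)) := by
  unfold edgeCut
  rw [← Finset.sum_subset (Finset.subset_univ A)]
  · refine Finset.sum_congr rfl fun x hx => ?_
    rw [← Finset.sum_subset (Finset.subset_univ Aᶜ)]
    · refine Finset.sum_congr rfl fun y hy => ?_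
      rw [Finset.mem_compl] at hy
      simp [hx, hy]
    · intro y _ hy
      rw [Finset.mem_compl, not_not] at hy
      simp [hy]
  · intro x _ hx
    simp [hx]

lemma sum_indicator_diff_eq_edgeCut (w : V → V → ℝ) (hw : ∀ x y, w x y = w y x) (A : Finset V) :
    ∑ x, ∑ y, w x y * |(if x ∈ A then (1 : ℝ) else 0) - (if y ∈ A then 1 else 0)|
      = 2 * edgeCut w A := by
  have h : edgeCut w A
      = ∑ x, ∑ y, w x y * ((if y ∈ A then 1 else 0) * (if x ∈ A then 0 else 1)) := by
    rw [edgeCut_eq_sum_indicator, Finset.sum_comm]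
    exact Finset.sum_congr rfl fun x _ => Finset.sum_congr rfl fun y _ => by rw [hw y x]
  rw [two_mul]
  nth_rewrite 1 [edgeCut_eq_sum_indicator]
  rw [h, ← Finset.sum_add_distrib]
  refine Finset.sum_congr rfl fun x _ => ?_
  rw [← Finset.sum_add_distrib]
  refine Finset.sum_congr rfl fun y _ => ?_
  split_ifs <;> simp

/-- The discrete co-area inequality. -/
lemma coarea_inequality (w : V → V → ℝ) (hw : ∀ x y, w x y = w y x) (m : V → ℝ)
    (hm : ∀ x, 0 ≤ m x) (Y : Finset V) (κ c : ℝ)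
    (hY : ∀ A ⊆ Y, ∑ x ∈ A, m x ≤ c → κ * ∑ x ∈ A, m x ≤ edgeCut w A) (f : V → ℝ)
    (hf : ∀ x, 0 ≤ f x) (hfY : ∀ x, f x ≠ 0 → x ∈ Y)
    (hfc : ∑ x with f x ≠ 0, m x ≤ c) :
    2 * κ * ∑ x, f x * m x ≤ ∑ x, ∑ y, w x y * |f x - f y| := by
  induction hk : (Finset.univ.filter fun x => f x ≠ 0).card using Nat.strong_induction_on
    generalizing f with
  | _ k ih =>
  subst hk
  set A := Finset.univ.filter fun x => f x ≠ 0 with hA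
  have memA : ∀ x, x ∈ A ↔ f x ≠ 0 := fun x => by simp [hA]
  rcases A.eq_empty_or_nonempty with h0 | hne
  · have : ∀ x, f x = 0 := fun x => by
      by_contra h
      have := (memA x).2 h
      simp [h0] at this
    simp [this]
  obtain ⟨z, hz, hmin⟩ := A.exists_min_image f hne
  -- Peel off the bottom layer: subtracting the least positive value on the support shrinks the
  -- support, and both sides drop by the contribution of `f z` times the indicator of `A`.
  set i : V → ℝ := fun x => if x ∈ A then 1 else 0 with hi
  set g : V → ℝ := fun x => f x - f z * i x with hg
  have g_in : ∀ x ∈ A, g x = f x - f z := fun x hx => by simp [hg, hi, hx]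
  have f_out : ∀ x, x ∉ A → f x = 0 := fun x hx => by
    by_contra h
    exact hx ((memA x).2 h)
  have g_out : ∀ x, x ∉ A → g x = 0 := fun x hx => by simp [hg, hi, hx, f_out x hx]
  have g_ne : ∀ x, g x ≠ 0 → x ∈ A := fun x hx => by
    by_contra h
    exact hx (g_out x h)
  have key := ih (Finset.univ.filter fun x => g x ≠ 0).card
    (Finset.card_lt_card (Finset.ssubset_iff_of_subset
      (fun x hx => g_ne x (by simpa using hx)) |>.2 ⟨z, hz, by simp [g_in z hz]⟩)) g
    (fun x => by
      by_cases hx : x ∈ A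
      · rw [g_in x hx]; linarith [hmin x hx]
      · rw [g_out x hx])
    (fun x hx => hfY x ((memA x).1 (g_ne x hx)))
    ((Finset.sum_le_sum_of_subset_of_nonneg (fun x hx => g_ne x (by simpa using hx))
      fun x _ _ => hm x).trans hfc) rfl
  have e1 : ∑ x, f x * m x = ∑ x, g x * m x + f z * ∑ x ∈ A, m x := by
    have : ∑ x ∈ A, m x = ∑ x, i x * m x := by simp [hi]
    rw [this, Finset.mul_sum, ← Finset.sum_add_distrib]
    exact Finset.sum_congr rfl fun x _ => by simp only [hg]; ring
  have e2 : ∑ x, ∑ y, w x y * |f x - f y|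
      = ∑ x, ∑ y, w x y * |g x - g y| + f z * (2 * edgeCut w A) := by
    rw [← sum_indicator_diff_eq_edgeCut w hw, Finset.mul_sum, ← Finset.sum_add_distrib]
    refine Finset.sum_congr rfl fun x _ => ?_
    rw [Finset.mul_sum, ← Finset.sum_add_distrib]
    refine Finset.sum_congr rfl fun y _ => ?_
    suffices |f x - f y| = |g x - g y| + f z * |i x - i y| by
      rw [this]; simp only [hi]; ring
    by_cases hx : x ∈ A <;> by_cases hy : y ∈ A
    · simp [g_in x hx, g_in y hy, hi, hx, hy]
    · simp only [g_in x hx, g_out y hy, f_out y hy, hi, hx, hy, if_true, if_false]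
      rw [sub_zero, sub_zero, abs_of_nonneg (hf x), abs_of_nonneg (by linarith [hmin x hx])]
      simp
    · simp only [g_in y hy, g_out x hx, f_out x hx, hi, hx, hy, if_true, if_false]
      rw [zero_sub, zero_sub, abs_neg, abs_neg, abs_of_nonneg (hf y),
        abs_of_nonneg (by linarith [hmin y hy])]
      simp
    · simp [g_out x hx, g_out y hy, f_out x hx, f_out y hy, hi, hx, hy]
  rw [e1, e2]
  have := mul_le_mul_of_nonneg_left (hY A (fun x hx => hfY x ((memA x).1 hx)) hfc) (hf z)
  linarith

/-- The Cheeger inequality for functions supported on a set of at most half measure. -/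
lemma cheeger_of_support (w : V → V → ℝ) (hw : ∀ x y, w x y = w y x) (hw0 : ∀ x y, 0 ≤ w x y)
    (m : V → ℝ) (hm : ∀ x, 0 ≤ m x) (N : ℝ) (hN : ∀ x, ∑ y, w x y ≤ N * m x) (Y : Finset V)
    (κ c : ℝ) (hκ : 0 ≤ κ)
    (hY : ∀ A ⊆ Y, ∑ x ∈ A, m x ≤ c → κ * ∑ x ∈ A, m x ≤ edgeCut w A) (f : V → ℝ)
    (hfY : ∀ x, f x ≠ 0 → x ∈ Y) (hfc : ∑ x with f x ≠ 0, m x ≤ c) :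
    κ ^ 2 * ∑ x, f x ^ 2 * m x ≤ N * ∑ x, ∑ y, w x y * (f x - f y) ^ 2 := by
  set S := ∑ x, f x ^ 2 * m x with hS
  set E := ∑ x, ∑ y, w x y * (f x - f y) ^ 2 with hE
  have hS0 : 0 ≤ S := Finset.sum_nonneg fun x _ => mul_nonneg (sq_nonneg _) (hm x)
  have hE0 : 0 ≤ E := Finset.sum_nonneg fun x _ => Finset.sum_nonneg fun y _ =>
    mul_nonneg (hw0 x y) (sq_nonneg _)
  -- Apply co-area to `f²`, factor `|f x² - f y²| = |f x - f y| |f x + f y|`, use Cauchy–Schwarz,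
  -- and finally cancel `4S`.
  have hco := coarea_inequality w hw m hm Y κ c hY (fun x => f x ^ 2) (fun x => sq_nonneg _)
    (fun x hx => hfY x fun h => hx (by simp [h])) (by simpa using hfc)
  have hsum : ∑ x, ∑ y, w x y * (f x + f y) ^ 2 ≤ 4 * N * S := by
    refine le_trans ?_ (sum_weight_add_sq_le w hw m N hN f)
    refine Finset.sum_le_sum fun x _ => Finset.sum_le_sum fun y _ =>
      mul_le_mul_of_nonneg_left (by nlinarith [sq_nonneg (f x - f y)]) (hw0 x y)
  have hcs : (∑ x, ∑ y, w x y * |f x ^ 2 - f y ^ 2|) ^ 2 ≤ E * (4 * N * S) := by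
    refine le_trans ?_ (mul_le_mul_of_nonneg_left hsum hE0)
    rw [hE]
    simp only [← Finset.sum_product']
    refine Finset.sum_sq_le_sum_mul_sum_of_sq_le_mul _ (fun p _ => mul_nonneg (hw0 _ _) (sq_nonneg _))
      (fun p _ => mul_nonneg (hw0 _ _) (sq_nonneg _)) fun p _ => le_of_eq ?_
    rw [mul_pow, sq_abs]
    ring
  have h4 : (2 * κ * S) ^ 2 ≤ E * (4 * N * S) :=
    (pow_le_pow_left₀ (by positivity) hco 2).trans hcs
  rcases hS0.eq_or_lt with h0 | hpos
  · rw [← h0] at hsum ⊢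
    rw [mul_zero]
    rcases le_or_gt 0 N with hN0 | hN0
    · positivity
    -- A negative `N` forces all weights to vanish.
    · have : ∀ x y, w x y = 0 := fun x y => le_antisymm
        ((Finset.single_le_sum (fun y _ => hw0 x y) (Finset.mem_univ y)).trans
          ((hN x).trans (mul_nonpos_of_nonpos_of_nonneg hN0.le (hm x)))) (hw0 x y)
      simp [hE, this]
  · nlinarith

/-- The Cheeger inequality: an isoperimetric inequality gives a spectral gap. -/
lemma cheeger_inequality (w : V → V → ℝ) (hw : ∀ x y, w x y = w y x) (hw0 : ∀ x y, 0 ≤ w x y)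
    (m : V → ℝ) (hm : ∀ x, 0 ≤ m x) (N : ℝ) (hN0 : 0 ≤ N) (hN : ∀ x, ∑ y, w x y ≤ N * m x)
    (Y : Finset V) (hwY : ∀ x y, w x y ≠ 0 → x ∈ Y ∧ y ∈ Y) (κ : ℝ) (hκ : 0 ≤ κ)
    (hY : ∀ A ⊆ Y, ∑ x ∈ A, m x ≤ (∑ x ∈ Y, m x) / 2 → κ * ∑ x ∈ A, m x ≤ edgeCut w A)
    (g : V → ℝ) (hg : ∑ x ∈ Y, g x * m x = 0) :
    κ ^ 2 * ∑ x ∈ Y, g x ^ 2 * m x ≤ N * ∑ x, ∑ y, w x y * (g x - g y) ^ 2 := by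
  rcases Y.eq_empty_or_nonempty with h0 | hYne
  · rw [h0]
    have := Finset.sum_nonneg fun x (_ : x ∈ Finset.univ) => Finset.sum_nonneg
      fun y (_ : y ∈ Finset.univ) => mul_nonneg (hw0 x y) (sq_nonneg (g x - g y))
    simpa using mul_nonneg hN0 this
  -- Splitting at a median makes the positive and negative parts of `g - s` each live on at most
  -- half of the mass.
  obtain ⟨s, hs1, hs2⟩ := exists_median m g hm Y hYne
  set p : V → ℝ := fun x => if x ∈ Y then max (g x - s) 0 else 0 with hp
  set q : V → ℝ := fun x => if x ∈ Y then max (s - g x) 0 else 0 with hq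
  have hpne : ∀ x, p x ≠ 0 → x ∈ Y ∧ s < g x := fun x hx => by
    simp only [hp, ne_eq, ite_eq_right_iff, not_forall] at hx
    obtain ⟨h1, h2⟩ := hx
    refine ⟨h1, lt_of_not_ge fun h => h2 (max_eq_right (by linarith))⟩
  have hqne : ∀ x, q x ≠ 0 → x ∈ Y ∧ g x < s := fun x hx => by
    simp only [hq, ne_eq, ite_eq_right_iff, not_forall] at hx
    obtain ⟨h1, h2⟩ := hx
    refine ⟨h1, lt_of_not_ge fun h => h2 (max_eq_right (by linarith))⟩
  have kp := cheeger_of_support w hw hw0 m hm N hN Y κ _ hκ hY p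
    (fun x hx => (hpne x hx).1)
    (le_trans (Finset.sum_le_sum_of_subset_of_nonneg
      (fun x hx => Finset.mem_filter.2 (hpne x (by simpa using hx))) fun x _ _ => hm x) hs1)
  have kq := cheeger_of_support w hw hw0 m hm N hN Y κ _ hκ hY q
    (fun x hx => (hqne x hx).1)
    (le_trans (Finset.sum_le_sum_of_subset_of_nonneg
      (fun x hx => Finset.mem_filter.2 (hqne x (by simpa using hx))) fun x _ _ => hm x) hs2)
  -- On `Y` the increments of `p` and `-q` add up to that of `g` and never have opposite signs, so
  -- the cross term has the right sign.
  have hE : ∑ x, ∑ y, w x y * (p x - p y) ^ 2 + ∑ x, ∑ y, w x y * (q x - q y) ^ 2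
      ≤ ∑ x, ∑ y, w x y * (g x - g y) ^ 2 := by
    rw [← Finset.sum_add_distrib]
    refine Finset.sum_le_sum fun x _ => ?_
    rw [← Finset.sum_add_distrib]
    refine Finset.sum_le_sum fun y _ => ?_
    rcases eq_or_ne (w x y) 0 with h0 | hne
    · simp [h0]
    obtain ⟨hx, hy⟩ := hwY x y hne
    rw [← mul_add]
    refine mul_le_mul_of_nonneg_left ?_ (hw0 x y)
    simp only [hp, hq, hx, hy, if_true]
    rcases le_total (g x) s with h1 | h1 <;> rcases le_total (g y) s with h2 | h2
    · rw [max_eq_right (by linarith), max_eq_right (by linarith), max_eq_left (by linarith),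
        max_eq_left (by linarith)]
      nlinarith
    · rw [max_eq_right (by linarith), max_eq_left (by linarith), max_eq_left (by linarith),
        max_eq_right (by linarith)]
      nlinarith [mul_nonneg (sub_nonneg.2 h1) (sub_nonneg.2 h2)]
    · rw [max_eq_left (by linarith), max_eq_right (by linarith), max_eq_right (by linarith),
        max_eq_left (by linarith)]
      nlinarith [mul_nonneg (sub_nonneg.2 h1) (sub_nonneg.2 h2)]
    · rw [max_eq_left (by linarith), max_eq_left (by linarith), max_eq_right (by linarith),
        max_eq_right (by linarith)]
      nlinarith
  -- As `g` has mean zero, replacing `g` by `g - s` can only increase the second moment.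
  have hS : ∑ x ∈ Y, g x ^ 2 * m x ≤ ∑ x, p x ^ 2 * m x + ∑ x, q x ^ 2 * m x := by
    have h1 : ∑ x, p x ^ 2 * m x + ∑ x, q x ^ 2 * m x = ∑ x ∈ Y, (g x - s) ^ 2 * m x := by
      rw [← Finset.sum_add_distrib, ← Finset.sum_subset (Finset.subset_univ Y)]
      · refine Finset.sum_congr rfl fun x hx => ?_
        simp only [hp, hq, hx, if_true]
        rcases le_total (g x) s with h | h
        · rw [max_eq_right (by linarith), max_eq_left (by linarith)]; ring
        · rw [max_eq_left (by linarith), max_eq_right (by linarith)]; ring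
      · intro x _ hx
        simp [hp, hq, hx]
    have h2 : ∑ x ∈ Y, (g x - s) ^ 2 * m x
        = ∑ x ∈ Y, g x ^ 2 * m x - 2 * s * ∑ x ∈ Y, g x * m x + s ^ 2 * ∑ x ∈ Y, m x := by
      rw [Finset.mul_sum, Finset.mul_sum, ← Finset.sum_sub_distrib, ← Finset.sum_add_distrib]
      exact Finset.sum_congr rfl fun x _ => by ring
    rw [h1, h2, hg]
    have := mul_nonneg (sq_nonneg s) (Finset.sum_nonneg fun x (_ : x ∈ Y) => hm x)
    linarith
  nlinarith [mul_le_mul_of_nonneg_left hS (sq_nonneg κ), mul_le_mul_of_nonneg_left hE hN0]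

end WeightedGraphs

/-! ### Powers of positive operators with a spectral gap -/

section SpectralGap

open scoped RealInnerProductSpace

variable {E : Type u} [NormedAddCommGroup E] [InnerProductSpace ℝ E]

/-- Cauchy–Schwarz for the positive form `⟪G u, v⟫` at `v = G u` gives `‖G u‖⁴ ≤ ρ² ‖u‖² ‖G u‖²`,
with no spectral theorem. -/
lemma norm_le_of_forall_inner_le (G : E →L[ℝ] E) (hG : ∀ u v, ⟪G u, v⟫ = ⟪u, G v⟫) (ρ : ℝ)
    (hρ : 0 ≤ ρ) (h0 : ∀ u, 0 ≤ ⟪G u, u⟫) (h1 : ∀ u, ⟪G u, u⟫ ≤ ρ * ‖u‖ ^ 2) : ‖G‖ ≤ ρ := by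
  refine G.opNorm_le_bound hρ fun u => ?_
  let B : LinearMap.BilinForm ℝ E := (innerₗ E).comp G.toLinearMap
  have hB : ∀ x y, B x y = ⟪G x, y⟫ := fun x y => rfl
  have := LinearMap.BilinForm.apply_sq_le_of_symm B (fun x => by rw [hB]; exact h0 x)
    ⟨fun x y => by simp [hB, hG x y, real_inner_comm]⟩ u (G u)
  rw [hB, hB, hB, real_inner_self_eq_norm_sq] at this
  have h2 : ‖G u‖ ^ 2 * ‖G u‖ ^ 2 ≤ (ρ * ‖u‖) ^ 2 * ‖G u‖ ^ 2 := by
    calc _ = (‖G u‖ ^ 2) ^ 2 := by ring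
      _ ≤ _ := this
      _ ≤ (ρ * ‖u‖ ^ 2) * (ρ * ‖G u‖ ^ 2) :=
        mul_le_mul (h1 u) (h1 _) (h0 _) (by positivity)
      _ = _ := by ring
  rcases (norm_nonneg (G u)).eq_or_lt with h | h
  · rw [← h]; positivity
  · exact (pow_le_pow_iff_left₀ (norm_nonneg _) (by positivity) two_ne_zero).1
      (le_of_mul_le_mul_right h2 (by positivity))

/-- Powers of a positive operator with a spectral gap below the eigenvalue `1` converge to the
projection onto the eigenline. -/
lemma norm_pow_sub_rankOne_le (T : E →L[ℝ] E) (hT : ∀ u v, ⟪T u, v⟫ = ⟪u, T v⟫) (η : E)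
    (hη : ‖η‖ = 1) (hTη : T η = η) (ρ : ℝ) (hρ : 0 ≤ ρ) (h0 : ∀ u, 0 ≤ ⟪T u, u⟫)
    (h1 : ∀ u, ⟪η, u⟫ = 0 → ⟪T u, u⟫ ≤ ρ * ‖u‖ ^ 2) (k : ℕ) :
    ‖T ^ (k + 1) - InnerProductSpace.rankOne ℝ η η‖ ≤ ρ ^ (k + 1) := by
  set P := InnerProductSpace.rankOne ℝ η η with hP
  have Papp : ∀ u, P u = ⟪η, u⟫ • η := fun u => rfl
  have hηη : ⟪η, η⟫ = 1 := by rw [real_inner_self_eq_norm_sq, hη, one_pow]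
  have hTP : T * P = P := by ext u; simp [Papp, hTη]
  have hPT : P * T = P := by
    ext u
    simp only [mul_apply_eq_comp, Papp]
    rw [← hT, hTη]
  have hPP : P * P = P := by ext u; simp only [mul_apply_eq_comp, Papp, inner_smul_right, hηη, mul_one]
  have hpowP : ∀ k : ℕ, T ^ k * P = P := fun k => by
    induction k with
    | zero => simp
    | succ k ih => rw [pow_succ, mul_assoc, hTP, ih]
  -- Follows from `TP = PT = P = P²`. The exponent must be positive: at exponent `0` the two sides
  -- are `1 - P` and `1`.
  have hpow : ∀ k : ℕ, T ^ (k + 1) - P = (T - P) ^ (k + 1) := fun k => by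
    induction k with
    | zero => simp
    | succ k ih =>
      rw [pow_succ (T - P), ← ih, sub_mul, mul_sub, mul_sub, hpowP, hPT, hPP, pow_succ]
      abel
  rw [hpow]
  refine (norm_pow_le' _ k.succ_pos).trans (pow_le_pow_left₀ (norm_nonneg _) ?_ _)
  -- Here `z` is the component of `u` orthogonal to `η`, so bounds for `T` on that complement become
  -- bounds for `T - P` everywhere.
  have form : ∀ u, ∃ z, ⟪η, z⟫ = 0 ∧ ‖z‖ ≤ ‖u‖ ∧ ⟪(T - P) u, u⟫ = ⟪T z, z⟫ := fun u => by
    have hz : ⟪η, u - ⟪η, u⟫ • η⟫ = 0 := by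
      rw [inner_sub_right, inner_smul_right, hηη, mul_one, sub_self]
    refine ⟨u - ⟪η, u⟫ • η, hz, ?_, ?_⟩
    · refine (pow_le_pow_iff_left₀ (norm_nonneg _) (norm_nonneg _) two_ne_zero).1 ?_
      rw [norm_sub_sq_real, inner_smul_right, norm_smul, hη, real_inner_comm, Real.norm_eq_abs,
        mul_one, sq_abs]
      nlinarith [sq_nonneg ⟪η, u⟫, real_inner_comm u η]
    · have h3 : ⟪T u, η⟫ = ⟪η, u⟫ := by rw [hT, hTη, real_inner_comm]
      simp only [sub_apply, Papp, map_sub, map_smul, hTη, inner_sub_left,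
        inner_sub_right, inner_smul_left, inner_smul_right, hηη, h3, conj_trivial]
      ring
  refine norm_le_of_forall_inner_le _ (fun u v => ?_) ρ hρ (fun u => ?_) fun u => ?_
  · simp only [sub_apply, Papp, inner_sub_left, inner_sub_right, hT,
      inner_smul_left, inner_smul_right, conj_trivial]
    rw [real_inner_comm u η]
    ring
  · obtain ⟨z, -, -, h⟩ := form u
    rw [h]; exact h0 z
  · obtain ⟨z, hz, hzu, h⟩ := form u
    rw [h]
    exact (h1 z hz).trans (by gcongr)

/-- Telescope: `|η⟩⟨η| - |ξ⟩⟨ξ| = |η - ξ⟩⟨η| + |ξ⟩⟨η - ξ|`. -/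
lemma norm_rankOne_sub_rankOne_le (ξ η : E) (hξ : ‖ξ‖ = 1) (hη : ‖η‖ = 1) :
    ‖InnerProductSpace.rankOne ℝ η η - InnerProductSpace.rankOne ℝ ξ ξ‖ ≤ 2 * ‖η - ξ‖ := by
  have : InnerProductSpace.rankOne ℝ η η - InnerProductSpace.rankOne ℝ ξ ξ
      = InnerProductSpace.rankOne ℝ (η - ξ) η + InnerProductSpace.rankOne ℝ ξ (η - ξ) := by
    simp [map_sub]
  rw [this]
  refine (norm_add_le _ _).trans ?_
  rw [InnerProductSpace.norm_rankOne, InnerProductSpace.norm_rankOne, hξ, hη]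
  linarith

end SpectralGap

/-! ### Propagation of matrix powers -/

section MatrixPropagation

variable {V : Type u} [MetricSpace V] [Fintype V] [DecidableEq V]

lemma dist_le_of_matrix_pow_ne_zero (K : Matrix V V ℝ) (R : ℝ)
    (hK : ∀ x y, K x y ≠ 0 → dist x y ≤ R) (k : ℕ) :
    ∀ x y, (K ^ k) x y ≠ 0 → dist x y ≤ k * R := by
  induction k with
  | zero =>
    intro x y h
    have : x = y := by
      by_contra hne
      exact h (by rw [pow_zero, Matrix.one_apply_ne hne])
    simp [this]
  | succ k ih =>
    intro x y h
    rw [pow_succ, Matrix.mul_apply] at h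
    obtain ⟨z, -, hz⟩ := Finset.exists_ne_zero_of_sum_ne_zero h
    have h1 := ih x z (left_ne_zero_of_mul hz)
    have h2 := hK z y (right_ne_zero_of_mul hz)
    have := dist_triangle x z y
    push_cast
    linarith

end MatrixPropagation

/-! ### The lazy random walk and its spectral gap -/

section RandomWalk

open scoped RealInnerProductSpace

variable {V : Type u} [Fintype V] [DecidableEq V]

/-- The lazy random walk operator on `Y` with respect to the weights `w` and the measure `m`,
conjugated to a symmetric matrix. -/
noncomputable def walkMatrix (w : V → V → ℝ) (m : V → ℝ) (Y : Finset V) (L : ℝ) : Matrix V V ℝ :=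
  Matrix.diagonal (fun x => if x ∈ Y then 1 - (∑ y, w x y) / (L * m x) else 0) +
    Matrix.of fun x y => w x y / (L * (√(m x) * √(m y)))

lemma walkMatrix_mulVec (w : V → V → ℝ) (m : V → ℝ) (Y : Finset V) (L : ℝ) (v : V → ℝ) (x : V) :
    ((walkMatrix w m Y L).mulVec v) x = (if x ∈ Y then 1 - (∑ y, w x y) / (L * m x) else 0) * v x
      + ∑ y, w x y / (L * (√(m x) * √(m y))) * v y := by
  rw [walkMatrix, Matrix.add_mulVec, Pi.add_apply, Matrix.mulVec_diagonal]
  rfl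

lemma walkMatrix_isHermitian (w : V → V → ℝ) (hw : ∀ x y, w x y = w y x) (m : V → ℝ) (Y : Finset V)
    (L : ℝ) : (walkMatrix w m Y L).IsHermitian := by
  refine Matrix.IsHermitian.add (Matrix.isHermitian_diagonal _) ?_
  ext x y
  simp [hw y x, mul_comm √(m y)]

/-- Substituting `v = √m · g` on `Y` turns the form into the mass of `v` on `Y` minus the Dirichlet
energy of `g`, to which Cheeger's inequality applies. -/
lemma walkMatrix_form (w : V → V → ℝ) (hw : ∀ x y, w x y = w y x) (m : V → ℝ)
    (hm : ∀ x, 0 ≤ m x) (Y : Finset V) (hwY : ∀ x y, w x y ≠ 0 → x ∈ Y ∧ y ∈ Y) (L : ℝ)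
    (v : V → ℝ) (g : V → ℝ) (hg : ∀ x, g x = if x ∈ Y then v x / √(m x) else 0) :
    (walkMatrix w m Y L).mulVec v ⬝ᵥ v
      = ∑ x ∈ Y, v x ^ 2 - (∑ x, ∑ y, w x y * (g x - g y) ^ 2) / (2 * L) := by
  have hdeg : ∑ x, ∑ y, w x y * g y ^ 2 = ∑ x, ∑ y, w x y * g x ^ 2 := by
    rw [Finset.sum_comm]
    exact Finset.sum_congr rfl fun x _ => Finset.sum_congr rfl fun y _ => by rw [hw y x]
  have hE : ∑ x, ∑ y, w x y * (g x - g y) ^ 2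
      = 2 * ∑ x, ∑ y, w x y * g x ^ 2 - 2 * ∑ x, ∑ y, w x y * (g x * g y) := by
    calc _ = ∑ x, ∑ y, w x y * g x ^ 2 + ∑ x, ∑ y, w x y * g y ^ 2
          - 2 * ∑ x, ∑ y, w x y * (g x * g y) := by
          simp only [Finset.mul_sum, ← Finset.sum_add_distrib, ← Finset.sum_sub_distrib]
          exact Finset.sum_congr rfl fun x _ => Finset.sum_congr rfl fun y _ => by ring
      _ = _ := by rw [hdeg]; ring
  have h1 : ∑ x ∈ Y, v x ^ 2 = ∑ x, (if x ∈ Y then 1 else 0) * v x ^ 2 := by simp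
  rw [hE, h1]
  have h2 : ∀ x y, w x y / (L * (√(m x) * √(m y))) * v y * v x = w x y * (g x * g y) / L := by
    intro x y
    rcases eq_or_ne (w x y) 0 with h0 | hne
    · simp [h0]
    · rw [hg, hg, if_pos (hwY x y hne).1, if_pos (hwY x y hne).2]
      field_simp
  have h3 : ∀ x, (if x ∈ Y then 1 - (∑ y, w x y) / (L * m x) else 0) * v x * v x
      = (if x ∈ Y then 1 else 0) * v x ^ 2 - (∑ y, w x y * g x ^ 2) / L := by
    intro x
    rw [← Finset.sum_mul, hg]
    split_ifs with hx
    · rw [div_pow, Real.sq_sqrt (hm x)]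
      field_simp
    · simp
  simp only [dotProduct, walkMatrix_mulVec, add_mul, Finset.sum_add_distrib, h3, Finset.sum_mul, h2,
    Finset.sum_sub_distrib, ← Finset.sum_div]
  field_simp
  ring

/-- The unit vector spanning the range of the averaging projection of `Y`. -/
noncomputable def averagingVector (m : V → ℝ) (Y : Finset V) : EuclideanSpace ℝ V :=
  WithLp.toLp 2 fun x => if x ∈ Y then √(m x) / √(∑ x ∈ Y, m x) else 0

lemma norm_averagingVector (m : V → ℝ) (hm : ∀ x, 0 ≤ m x) (Y : Finset V)
    (hY : 0 < ∑ x ∈ Y, m x) : ‖averagingVector m Y‖ = 1 := by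
  rw [EuclideanSpace.norm_eq, Real.sqrt_eq_one]
  simp only [averagingVector, Real.norm_eq_abs, sq_abs, ite_pow, div_pow, Real.sq_sqrt (hm _),
    Real.sq_sqrt hY.le, zero_pow two_ne_zero]
  rw [Finset.sum_ite_mem, Finset.univ_inter, ← Finset.sum_div, div_self hY.ne']

/-- Reversibility: along `√m`, the off-diagonal entries of a row return exactly what the diagonal
entry loses. -/
lemma walkMatrix_averagingVector (w : V → V → ℝ) (m : V → ℝ) (Y : Finset V)
    (hm : ∀ x ∈ Y, 0 < m x) (hwY : ∀ x y, w x y ≠ 0 → x ∈ Y ∧ y ∈ Y) (L : ℝ) :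
    Matrix.toEuclideanCLM (𝕜 := ℝ) (walkMatrix w m Y L) (averagingVector m Y)
      = averagingVector m Y := by
  rw [averagingVector, Matrix.toEuclideanCLM_toLp]
  congr 1
  ext x
  rw [walkMatrix_mulVec]
  by_cases hx : x ∈ Y
  · have h1 : ∀ y, w x y / (L * (√(m x) * √(m y))) * (if y ∈ Y then √(m y) / √(∑ x ∈ Y, m x) else 0)
        = w x y / (L * √(m x)) / √(∑ x ∈ Y, m x) := by
      intro y
      rcases eq_or_ne (w x y) 0 with h0 | hne
      · simp [h0]
      · rw [if_pos (hwY x y hne).2]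
        have := (Real.sqrt_pos.2 (hm y (hwY x y hne).2)).ne'
        field_simp
    simp only [h1, if_pos hx, ← Finset.sum_div]
    have h2 := (Real.sqrt_pos.2 (hm x hx)).ne'
    have h3 : (∑ y, w x y) / (L * m x) * √(m x) = (∑ y, w x y) / (L * √(m x)) := by
      nth_rewrite 1 [← Real.mul_self_sqrt (hm x hx).le]
      field_simp
    rw [← h3]
    ring
  · have : ∀ y, w x y = 0 := fun y => by
      by_contra h
      exact hx (hwY x y h).1
    simp [hx, this]

/-- An isoperimetric inequality on `Y` makes the powers of the lazy random walk converge in norm. -/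
lemma norm_walkMatrix_pow_sub_le (w : V → V → ℝ) (hw : ∀ x y, w x y = w y x)
    (hw0 : ∀ x y, 0 ≤ w x y) (m : V → ℝ) (hm : ∀ x, 0 ≤ m x) (N : ℝ) (hN1 : 1 ≤ N)
    (hN : ∀ x, ∑ y, w x y ≤ N * m x) (Y : Finset V) (hYpos : 0 < ∑ x ∈ Y, m x)
    (hmY : ∀ x ∈ Y, 0 < m x) (hwY : ∀ x y, w x y ≠ 0 → x ∈ Y ∧ y ∈ Y) (κ : ℝ) (hκ : 0 ≤ κ)
    (hκ1 : κ ≤ 1)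
    (hY : ∀ A ⊆ Y, ∑ x ∈ A, m x ≤ (∑ x ∈ Y, m x) / 2 → κ * ∑ x ∈ A, m x ≤ edgeCut w A) (k : ℕ) :
    ‖Matrix.toEuclideanCLM (𝕜 := ℝ) (walkMatrix w m Y (2 * N)) ^ (k + 1)
      - InnerProductSpace.rankOne ℝ (averagingVector m Y) (averagingVector m Y)‖
      ≤ (1 - κ ^ 2 / (4 * N ^ 2)) ^ (k + 1) := by
  have hN0 : 0 < N := by linarith
  -- With `L = 2N` the probability of leaving a point is at most `1/2`, which makes `T` positive.
  -- The form is then `∑_Y u²` minus energy over `4N`, and Cheeger bounds the energy below by `κ²/N`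
  -- times `∑_Y u²`.
  set T := Matrix.toEuclideanCLM (𝕜 := ℝ) (walkMatrix w m Y (2 * N)) with hT
  have hform : ∀ u : EuclideanSpace ℝ V, ∃ g : V → ℝ, (∀ x ∈ Y, g x = u x / √(m x)) ∧
      ∑ x, g x ^ 2 * m x = ∑ x ∈ Y, u x ^ 2 ∧
      ⟪T u, u⟫ = ∑ x ∈ Y, u x ^ 2 - (∑ x, ∑ y, w x y * (g x - g y) ^ 2) / (4 * N) := by
    intro u
    refine ⟨fun x => if x ∈ Y then u x / √(m x) else 0, fun x hx => if_pos hx, ?_, ?_⟩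
    · rw [← Finset.sum_subset (Finset.subset_univ Y)]
      · refine Finset.sum_congr rfl fun x hx => ?_
        simp only [if_pos hx, div_pow]
        rw [Real.sq_sqrt (hm x), div_mul_cancel₀ _ (hmY x hx).ne']
      · intro x _ hx
        simp [hx]
    · rw [real_inner_comm, Matrix.inner_toEuclideanCLM, dotProduct_comm,
        walkMatrix_form w hw m hm Y hwY (2 * N) _ _ fun x => rfl]
      ring_nf
  have hsq : ∀ u : EuclideanSpace ℝ V, ∑ x ∈ Y, u x ^ 2 ≤ ‖u‖ ^ 2 := fun u => by
    rw [EuclideanSpace.real_norm_sq_eq]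
    exact Finset.sum_le_sum_of_subset_of_nonneg (Finset.subset_univ _) fun x _ _ => sq_nonneg _
  have hρ : 0 ≤ 1 - κ ^ 2 / (4 * N ^ 2) := by
    rw [sub_nonneg, div_le_one (by positivity)]
    nlinarith
  refine norm_pow_sub_rankOne_le T (fun u v => ?_) _ (norm_averagingVector m hm Y hYpos)
    (walkMatrix_averagingVector w m Y hmY hwY _) _ hρ (fun u => ?_) (fun u hu => ?_) k
  · have hsa : IsSelfAdjoint T := by
      have : IsSelfAdjoint (walkMatrix w m Y (2 * N)) := walkMatrix_isHermitian w hw m Y _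
      exact this.map _
    exact hsa.isSymmetric u v
  · obtain ⟨g, -, hg2, hg⟩ := hform u
    rw [hg, sub_nonneg, div_le_iff₀ (by positivity)]
    have h1 := sum_weight_add_sq_le w hw m N hN g
    rw [hg2] at h1
    refine le_trans (Finset.sum_le_sum fun x _ => Finset.sum_le_sum fun y _ =>
      mul_le_mul_of_nonneg_left (?_ : _ ≤ 2 * g x ^ 2 + 2 * g y ^ 2) (hw0 x y)) (h1.trans_eq
        (mul_comm _ _))
    nlinarith [sq_nonneg (g x + g y)]
  · obtain ⟨g, hgY, hg2, hg⟩ := hform u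
    have hmean : ∑ x ∈ Y, g x * m x = 0 := by
      have h1 : ⟪averagingVector m Y, u⟫ = (∑ x ∈ Y, g x * m x) / √(∑ x ∈ Y, m x) := by
        rw [PiLp.inner_apply, Finset.sum_div, ← Finset.sum_subset (Finset.subset_univ Y)]
        · refine Finset.sum_congr rfl fun x hx => ?_
          have h2 := (Real.sqrt_pos.2 (hmY x hx)).ne'
          have h3 : g x * m x = u x * √(m x) := by
            rw [hgY x hx]
            nth_rewrite 2 [← Real.mul_self_sqrt (hmY x hx).le]
            field_simp
          rw [h3]
          simp [averagingVector, hx]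
          ring
        · intro x _ hx
          simp [averagingVector, hx]
      rw [h1, div_eq_zero_iff] at hu
      exact hu.resolve_right (Real.sqrt_pos.2 hYpos).ne'
    have hch := cheeger_inequality w hw hw0 m hm N hN0.le hN Y hwY κ hκ hY g hmean
    have hgs : ∑ x ∈ Y, g x ^ 2 * m x = ∑ x ∈ Y, u x ^ 2 := by
      refine Finset.sum_congr rfl fun x hx => ?_
      rw [hgY x hx, div_pow, Real.sq_sqrt (hm x), div_mul_cancel₀ _ (hmY x hx).ne']
    rw [hgs] at hch
    refine le_trans ?_ (mul_le_mul_of_nonneg_left (hsq u) hρ)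
    rw [hg, sub_mul, one_mul, sub_le_sub_iff_left, le_div_iff₀ (by positivity)]
    rw [div_mul_eq_mul_div, div_mul_eq_mul_div, div_le_iff₀ (by positivity)]
    nlinarith

end RandomWalk

/-! ### From boundary expansion to edge expansion at all scales -/

section Expansion

variable {V : Type u} [MetricSpace V]

/-- Points at distance at most `R` are joined by an edge weighted by the smaller of their masses. -/
noncomputable def minWeight (m : V → ℝ) (R : ℝ) (x y : V) : ℝ :=
  if dist x y ≤ R then min (m x) (m y) else 0

lemma minWeight_comm (m : V → ℝ) (R : ℝ) (x y : V) : minWeight m R x y = minWeight m R y x := by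
  simp only [minWeight, dist_comm x y, min_comm (m x)]

lemma minWeight_nonneg (m : V → ℝ) (hm : ∀ x, 0 ≤ m x) (R : ℝ) (x y : V) :
    0 ≤ minWeight m R x y := by
  unfold minWeight
  split_ifs
  · exact le_min (hm x) (hm y)
  · exact le_rfl

variable [Fintype V]

lemma mem_outerBoundary {R : ℝ} {A : Finset V} {x : V} :
    x ∈ outerBoundary R A ↔ x ∉ A ∧ ∃ a ∈ A, dist x a ≤ R := by
  simp [outerBoundary]

lemma sum_minWeight_le (m : V → ℝ) (hm : ∀ x, 0 ≤ m x) (R : ℝ) (N : ℕ)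
    (hN : ∀ x : V, (Finset.univ.filter fun y => dist x y ≤ R).card ≤ N) (x : V) :
    ∑ y, minWeight m R x y ≤ N * m x := by
  unfold minWeight
  rw [← Finset.sum_filter]
  refine (Finset.sum_le_card_nsmul _ _ (m x) fun y _ => min_le_left _ _).trans ?_
  rw [nsmul_eq_mul]
  exact mul_le_mul_of_nonneg_right (by exact_mod_cast hN x) (hm x)

variable [DecidableEq V]

/-- Expansion with respect to the mass of outer boundaries gives expansion with respect to the
edge weights `minWeight`. -/
lemma lt_edgeCut_minWeight (m : V → ℝ) (hm : ∀ x, 0 ≤ m x) (hm1 : ∑ x, m x = 1) (R : ℝ) (N : ℕ)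
    (hN0 : 1 ≤ N) (hN : ∀ x : V, (Finset.univ.filter fun y => dist x y ≤ R).card ≤ N) (c α : ℝ)
    (hc : 0 < c) (hc1 : c < 1) (hα : 0 < α)
    (hA : ∀ A : Finset V, α / 2 ≤ ∑ x ∈ A, m x → ∑ x ∈ A, m x ≤ 1 / 2 →
      c * ∑ x ∈ A, m x < ∑ x ∈ outerBoundary R A, m x)
    (A : Finset V) (h1 : α ≤ ∑ x ∈ A, m x) (h2 : ∑ x ∈ A, m x ≤ 1 / 2) :
    (c * α) ^ 2 / (16 * N) < edgeCut (minWeight m R) A := by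
  have hN' : (1 : ℝ) ≤ N := by exact_mod_cast hN0
  -- Chosen so that the exceptional set `B` has mass at most `N / s = cα/4`.
  set s : ℝ := 4 * N / (c * α) with hs
  have hcα : 0 < c * α := mul_pos hc hα
  have hcα1 : c * α ≤ 1 := by nlinarith
  have hs1 : 1 ≤ s := by rw [hs, one_le_div hcα]; linarith
  have hs0 : 0 < s := by linarith
  -- The points with a much heavier neighbour outside `A`: there the minimum weight does not see the
  -- boundary mass. Each outside point is charged at most `N` times.
  set B := A.filter fun x => ∃ y ∉ A, dist x y ≤ R ∧ s * m x < m y with hB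
  have hBA : B ⊆ A := Finset.filter_subset _ _
  have hBm : ∑ x ∈ B, m x ≤ c * α / 4 := by
    have e1 : ∀ x ∈ B, m x ≤ ∑ y with dist x y ≤ R, m y / s := fun x hx => by
      obtain ⟨-, y, -, hy, hxy⟩ := Finset.mem_filter.1 hx
      refine le_trans ?_ (Finset.single_le_sum (f := fun y => m y / s)
        (fun y _ => div_nonneg (hm y) hs0.le) (Finset.mem_filter.2 ⟨Finset.mem_univ y, hy⟩))
      rw [le_div_iff₀ hs0]
      linarith
    calc ∑ x ∈ B, m x ≤ ∑ x ∈ B, ∑ y with dist x y ≤ R, m y / s := Finset.sum_le_sum e1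
      _ ≤ ∑ x, ∑ y with dist x y ≤ R, m y / s :=
        Finset.sum_le_sum_of_subset_of_nonneg (Finset.subset_univ _) fun x _ _ =>
          Finset.sum_nonneg fun y _ => div_nonneg (hm y) hs0.le
      _ = ∑ y, ∑ x with dist y x ≤ R, m y / s := by
        simp only [Finset.sum_filter]
        rw [Finset.sum_comm]
        simp only [dist_comm]
      _ ≤ ∑ y, N * (m y / s) := by
        refine Finset.sum_le_sum fun y _ => ?_
        rw [Finset.sum_const, nsmul_eq_mul]
        exact mul_le_mul_of_nonneg_right (by exact_mod_cast hN y) (div_nonneg (hm y) hs0.le)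
      _ = c * α / 4 := by
        rw [← Finset.mul_sum, ← Finset.sum_div, hm1, hs]
        field_simp
  have hsplit := Finset.sum_sdiff (f := m) hBA
  -- Removing `B` leaves mass at least `α/2`, which is why expansion is assumed from `α/2` on.
  have hbd := hA (A \ B) (by nlinarith)
    ((Finset.sum_le_sum_of_subset_of_nonneg Finset.sdiff_subset fun x _ _ => hm x).trans h2)
  have hsub : ∑ x ∈ outerBoundary R (A \ B), m x ≤ ∑ x ∈ B, m x + s * edgeCut (minWeight m R) A := by
    have e2 : outerBoundary R (A \ B) ⊆ B ∪ (Aᶜ).filter fun y => y ∈ outerBoundary R (A \ B) := by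
      intro y hy
      obtain ⟨h3, -⟩ := mem_outerBoundary.1 hy
      by_cases hyA : y ∈ A
      · have : y ∈ B := by simpa [hyA] using h3
        exact Finset.mem_union_left _ this
      · exact Finset.mem_union_right _ (Finset.mem_filter.2 ⟨Finset.mem_compl.2 hyA, hy⟩)
    have e3 : ∀ y ∈ (Aᶜ).filter fun y => y ∈ outerBoundary R (A \ B),
        m y ≤ s * ∑ x ∈ A, minWeight m R x y := by
      intro y hy
      obtain ⟨hyA, hy⟩ := Finset.mem_filter.1 hy
      rw [Finset.mem_compl] at hyA
      obtain ⟨-, x, hx, hxy⟩ := mem_outerBoundary.1 hy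
      obtain ⟨hxA, hxB⟩ := Finset.mem_sdiff.1 hx
      rw [dist_comm] at hxy
      have h4 : m y ≤ s * m x := by
        by_contra h
        exact hxB (Finset.mem_filter.2 ⟨hxA, y, hyA, hxy, not_le.1 h⟩)
      refine le_trans ?_ (mul_le_mul_of_nonneg_left (Finset.single_le_sum
        (f := fun x => minWeight m R x y) (fun x _ => minWeight_nonneg m hm R x y) hxA) hs0.le)
      simp only [minWeight, if_pos hxy]
      rw [mul_min_of_nonneg _ _ hs0.le]
      exact le_min h4 (by nlinarith [hm y])
    refine (Finset.sum_le_sum_of_subset_of_nonneg e2 fun x _ _ => hm x).trans ?_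
    refine (Finset.sum_union_inter (s₁ := B) (f := m) ▸ le_add_of_nonneg_right
      (Finset.sum_nonneg fun x _ => hm x)).trans ?_
    refine add_le_add_right ((Finset.sum_le_sum e3).trans ?_) _
    rw [← Finset.mul_sum, show edgeCut (minWeight m R) A = ∑ y ∈ Aᶜ, ∑ x ∈ A, minWeight m R x y from
      Finset.sum_comm]
    refine mul_le_mul_of_nonneg_left (Finset.sum_le_sum_of_subset_of_nonneg
      (Finset.filter_subset _ _) fun y _ _ => ?_) hs0.le
    exact Finset.sum_nonneg fun x _ => minWeight_nonneg m hm R x y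
  have h5 : c * α / 4 < s * edgeCut (minWeight m R) A := by nlinarith
  rw [div_lt_iff₀ (by positivity)]
  rw [hs, div_mul_eq_mul_div, lt_div_iff₀ hcα] at h5
  linarith

/-- Expansion of the sets of measure between `α` and `1 - α` gives a large subset which expands at
all scales. -/
lemma exists_expanding_subset {V : Type u} [Fintype V] [DecidableEq V] (w : V → V → ℝ)
    (hw0 : ∀ x y, 0 ≤ w x y) (m : V → ℝ) (hm1 : ∑ x, m x = 1) (α κ : ℝ)
    (hα : α ≤ 1 / 3) (hκ : 0 ≤ κ)
    (h : ∀ A : Finset V, α ≤ ∑ x ∈ A, m x → ∑ x ∈ A, m x ≤ 1 - α → κ < edgeCut w A) (hα0 : 0 < α) :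
    ∃ Y : Finset V, 1 - α ≤ ∑ x ∈ Y, m x ∧ ∀ A ⊆ Y, A.Nonempty →
      ∑ x ∈ A, m x ≤ (∑ x ∈ Y, m x) / 2 →
      κ * ∑ x ∈ A, m x < edgeCut (fun x y => if x ∈ Y ∧ y ∈ Y then w x y else 0) A := by
  -- A badly expanding `F` of maximal cardinality; its complement is the required `Y`. The
  -- hypothesis excludes measures in `[α, 1 - α]`, so `F` has measure below `α`.
  set C := (Finset.univ : Finset (Finset V)).filter fun F =>
    ∑ x ∈ F, m x ≤ 1 - α ∧ edgeCut w F ≤ κ * ∑ x ∈ F, m x with hC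
  have hCne : C.Nonempty := ⟨∅, Finset.mem_filter.2 ⟨Finset.mem_univ _, by simpa using by linarith, by simp [edgeCut]⟩⟩
  obtain ⟨F, hF, hmax⟩ := C.exists_max_image Finset.card hCne
  obtain ⟨-, hF1, hF2⟩ := Finset.mem_filter.1 hF
  have hFα : ∑ x ∈ F, m x < α := by
    by_contra hcon
    have h3 := h F (not_lt.1 hcon) hF1
    nlinarith
  have hcompl := Finset.sum_compl_add_sum F m
  rw [hm1] at hcompl
  refine ⟨Fᶜ, by linarith, fun A hA hne hAm => ?_⟩
  by_contra hcon
  rw [not_lt] at hcon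
  have hdisj : Disjoint F A := Finset.disjoint_left.2 fun x hx hxA => Finset.mem_compl.1 (hA hxA) hx
  have hcut : edgeCut w (F ∪ A) ≤ edgeCut w F
      + edgeCut (fun x y => if x ∈ Fᶜ ∧ y ∈ Fᶜ then w x y else 0) A := by
    unfold edgeCut
    rw [Finset.sum_union hdisj]
    refine add_le_add (Finset.sum_le_sum fun x _ => Finset.sum_le_sum_of_subset_of_nonneg
      (fun y hy => ?_) fun y _ _ => hw0 x y) (Finset.sum_le_sum fun x hx => ?_)
    · simp only [Finset.mem_compl, Finset.mem_union, not_or] at hy ⊢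
      exact hy.1
    · calc ∑ y ∈ (F ∪ A)ᶜ, w x y
          = ∑ y ∈ (F ∪ A)ᶜ, (if x ∈ Fᶜ ∧ y ∈ Fᶜ then w x y else 0) := by
            refine Finset.sum_congr rfl fun y hy => ?_
            simp only [Finset.mem_compl, Finset.mem_union, not_or] at hy
            rw [if_pos ⟨hA hx, Finset.mem_compl.2 hy.1⟩]
        _ ≤ _ := by
            refine Finset.sum_le_sum_of_subset_of_nonneg (fun y hy => ?_) fun y _ _ => ?_
            · simp only [Finset.mem_compl, Finset.mem_union, not_or] at hy ⊢
              exact hy.2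
            · split_ifs
              · exact hw0 x y
              · exact le_rfl
  -- A bad `A` in the complement would enlarge `F`. The measure bound holds because `(1 + α)/2 ≤ 1 -
  -- α`, that is, `α ≤ 1/3`.
  have hmem : F ∪ A ∈ C := by
    refine Finset.mem_filter.2 ⟨Finset.mem_univ _, ?_, ?_⟩ <;> rw [Finset.sum_union hdisj] <;>
      linarith
  have := hmax _ hmem
  rw [Finset.card_union_of_disjoint hdisj] at this
  have := hne.card_pos
  omega

end Expansion

/-! ### Finite-propagation approximation of averaging projections -/

section Approximation

/-- The averaging vector of a set of almost full measure is close to that of the whole space. -/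
lemma norm_averagingVector_sub_le {V : Type u} [Fintype V] [DecidableEq V] (m : V → ℝ)
    (hm : ∀ x, 0 ≤ m x) (hm1 : ∑ x, m x = 1) (α : ℝ) (Y : Finset V) (hYpos : 0 < ∑ x ∈ Y, m x)
    (hY : 1 - α ≤ ∑ x ∈ Y, m x) :
    ‖averagingVector m Y - averagingVector m Finset.univ‖ ≤ √(2 * α) := by
  have hle : ∑ x ∈ Y, m x ≤ 1 := hm1 ▸
    Finset.sum_le_sum_of_subset_of_nonneg (Finset.subset_univ _) fun x _ _ => hm x
  refine Real.le_sqrt_of_sq_le ?_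
  rw [norm_sub_sq_real, norm_averagingVector m hm Y hYpos,
    norm_averagingVector m hm Finset.univ (by rw [hm1]; exact one_pos)]
  have h1 : inner ℝ (averagingVector m Y) (averagingVector m Finset.univ) = √(∑ x ∈ Y, m x) := by
    rw [PiLp.inner_apply]
    simp only [averagingVector, hm1, Real.sqrt_one, div_one, Finset.mem_univ, if_true]
    simp only [RCLike.inner_apply, conj_trivial, mul_ite, mul_zero, Finset.sum_ite_mem,
      Finset.univ_inter, ← mul_div_assoc, Real.mul_self_sqrt (hm _), ← Finset.sum_div,
      Real.div_sqrt]
  -- The squared distance is `2 - 2√m(Y)`, at most `2 - 2 m(Y) ≤ 2α`.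
  have h2 : ∑ x ∈ Y, m x ≤ √(∑ x ∈ Y, m x) := by
    refine Real.le_sqrt_of_sq_le ?_
    nlinarith
  rw [h1]
  linarith

/-- The averaging projection of a finite space satisfying the isoperimetric inequality of measured
asymptotic expanders is approximated by a matrix whose propagation depends only on the constants. -/
lemma exists_matrix_near_averaging {V : Type u} [MetricSpace V] [Fintype V] [DecidableEq V]
    (m : V → ℝ) (hm : ∀ x, 0 ≤ m x) (hm1 : ∑ x, m x = 1) (R : ℝ) (hR : 0 ≤ R) (N : ℕ) (hN0 : 1 ≤ N)
    (hN : ∀ x : V, (Finset.univ.filter fun y => dist x y ≤ R).card ≤ N) (c α : ℝ)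
    (hc : 0 < c) (hc1 : c < 1) (hα : 0 < α) (hα3 : α ≤ 1 / 3)
    (hA : ∀ A : Finset V, α / 2 ≤ ∑ x ∈ A, m x → ∑ x ∈ A, m x ≤ 1 / 2 →
      c * ∑ x ∈ A, m x < ∑ x ∈ outerBoundary R A, m x) (k : ℕ) :
    ∃ K : Matrix V V ℝ, (∀ x y, K x y ≠ 0 → dist x y ≤ (k + 1) * R) ∧
      ‖Matrix.toEuclideanCLM (𝕜 := ℝ) K - InnerProductSpace.rankOne ℝ
          (averagingVector m Finset.univ) (averagingVector m Finset.univ)‖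
        ≤ (1 - ((c * α) ^ 2 / (16 * N)) ^ 2 / (4 * N ^ 2)) ^ (k + 1) + 2 * √(2 * α) := by
  set κ : ℝ := (c * α) ^ 2 / (16 * N) with hκdef
  have hN' : (1 : ℝ) ≤ N := by exact_mod_cast hN0
  have hκ : 0 ≤ κ := by positivity
  have hκ1 : κ ≤ 1 := by
    rw [hκdef, div_le_one (by positivity)]
    have : c * α ≤ 1 := by nlinarith
    nlinarith [mul_pos hc hα]
  have hcut : ∀ A : Finset V, α ≤ ∑ x ∈ A, m x → ∑ x ∈ A, m x ≤ 1 - α →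
      κ < edgeCut (minWeight m R) A := by
    intro A h1 h2
    rcases le_total (∑ x ∈ A, m x) (1 / 2) with h | h
    · exact lt_edgeCut_minWeight m hm hm1 R N hN0 hN c α hc hc1 hα hA A h1 h
    · have := Finset.sum_compl_add_sum A m
      rw [hm1] at this
      rw [← edgeCut_compl _ (minWeight_comm m R)]
      exact lt_edgeCut_minWeight m hm hm1 R N hN0 hN c α hc hc1 hα hA Aᶜ (by linarith) (by linarith)
  obtain ⟨Y, hYm, hY⟩ := exists_expanding_subset (minWeight m R) (minWeight_nonneg m hm R) m hm1
    α κ hα3 hκ hcut hα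
  have hYpos : 0 < ∑ x ∈ Y, m x := by linarith
  set w : V → V → ℝ := fun x y => if x ∈ Y ∧ y ∈ Y then minWeight m R x y else 0 with hw
  have hwle : ∀ x y, w x y ≤ minWeight m R x y := fun x y => by
    simp only [hw]
    split_ifs
    · exact le_rfl
    · exact minWeight_nonneg m hm R x y
  have hw0 : ∀ x y, 0 ≤ w x y := fun x y => by
    simp only [hw]
    split_ifs
    · exact minWeight_nonneg m hm R x y
    · exact le_rfl
  have hwY : ∀ x y, w x y ≠ 0 → x ∈ Y ∧ y ∈ Y := fun x y h => by
    by_contra hcon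
    exact h (if_neg hcon)
  have hwR : ∀ x y, w x y ≠ 0 → dist x y ≤ R := fun x y h => by
    by_contra hcon
    exact h (by simp [hw, minWeight, hcon])
  -- A null point of `Y` would be a set with zero cut, against the strict expansion inequality.
  have hmY : ∀ x ∈ Y, 0 < m x := fun x hx => by
    by_contra hcon
    have h0 : m x = 0 := le_antisymm (not_lt.1 hcon) (hm x)
    have h1 := hY {x} (by simpa using hx) (by simp) (by rw [Finset.sum_singleton, h0]; positivity)
    have h2 : edgeCut w {x} ≤ 0 := by
      rw [edgeCut, Finset.sum_singleton]
      refine Finset.sum_nonpos fun y _ => (hwle x y).trans ?_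
      unfold minWeight
      split_ifs
      · exact h0 ▸ min_le_left _ _
      · exact le_rfl
    rw [Finset.sum_singleton, h0, mul_zero] at h1
    exact absurd h1 (not_lt.2 h2)
  refine ⟨walkMatrix w m Y (2 * N) ^ (k + 1), fun x y hxy => ?_, ?_⟩
  · have := dist_le_of_matrix_pow_ne_zero (walkMatrix w m Y (2 * N)) R (fun x y h => ?_) _ x y hxy
    · exact_mod_cast this
    · rcases eq_or_ne x y with rfl | hne
      · simpa using hR
      · refine hwR x y fun h0 => h ?_
        simp [walkMatrix, hne, h0]
  · have h1 := norm_walkMatrix_pow_sub_le w (fun x y => by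
      simp only [hw, minWeight_comm m R x y, and_comm]) hw0 m hm N hN' (fun x =>
      (Finset.sum_le_sum fun y _ => hwle x y).trans (sum_minWeight_le m hm R N hN x)) Y hYpos hmY hwY
      κ hκ hκ1 (fun A hAY hAm => by
        rcases A.eq_empty_or_nonempty with rfl | hne
        · simp [edgeCut]
        · exact (hY A hAY hne hAm).le) k
    have h2 := norm_rankOne_sub_rankOne_le (averagingVector m Finset.univ) (averagingVector m Y)
      (norm_averagingVector m hm _ (by rw [hm1]; exact one_pos)) (norm_averagingVector m hm Y hYpos)
    have h3 := norm_averagingVector_sub_le m hm hm1 α Y hYpos hYm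
    rw [map_pow]
    refine (norm_sub_le_norm_sub_add_norm_sub _ _ _).trans (add_le_add h1 (h2.trans ?_))
    linarith

/-- The averaging projections of measured asymptotic expanders with uniformly bounded geometry are
uniformly approximated by matrices of finite propagation. -/
theorem MeasuredAsymptoticExpanders.exists_matrix_near (V : ℕ → Type u) [∀ n, MetricSpace (V n)]
    [∀ n, Fintype (V n)] (m : ∀ n, V n → ℝ) (hV : UniformlyBoundedGeometry V)
    (hm : ∀ n, m n ∈ stdSimplex ℝ (V n)) (hM : MeasuredAsymptoticExpanders V m) (ε : ℝ)
    (hε : 0 < ε) :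
    ∃ R : ℝ, ∀ n, ∃ K : V n → V n → ℝ, (∀ x y, K x y ≠ 0 → dist x y ≤ R) ∧
      ∀ v : V n → ℝ, ∑ x, (∑ y, (K x y - √(m n x) * √(m n y)) * v y) ^ 2
        ≤ ε ^ 2 * ∑ x, v x ^ 2 := by
  classical
  obtain ⟨α, hα, hα3, hαε⟩ : ∃ α : ℝ, 0 < α ∧ α ≤ 1 / 3 ∧ 2 * √(2 * α) ≤ ε / 2 := by
    -- The bound `ε²/32` gives `√(2α) ≤ ε/4`; half of `ε` is left for the power of the walk.
    refine ⟨min (1 / 3) (ε ^ 2 / 32), by positivity, min_le_left _ _, ?_⟩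
    have : √(2 * min (1 / 3) (ε ^ 2 / 32)) ≤ √((ε / 4) ^ 2) :=
      Real.sqrt_le_sqrt (by linarith [min_le_right (1 / 3) (ε ^ 2 / 32)])
    rw [Real.sqrt_sq (by positivity)] at this
    linarith
  obtain ⟨c, hc, hc1, R, hR, hA⟩ := hM (α / 2) (by linarith) (by linarith)
  obtain ⟨N, hN⟩ := hV R hR
  have hN1 : (1 : ℝ) ≤ (max N 1 : ℕ) := by exact_mod_cast le_max_right N 1
  have hcard : ∀ n (x : V n), (Finset.univ.filter fun y => dist x y ≤ R).card ≤ max N 1 := by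
    intro n x
    have h1 := hN n x
    have h2 : Metric.closedBall x R = ((Finset.univ.filter fun y => dist x y ≤ R : Finset (V n)) :
        Set (V n)) := by
      ext y
      simp [dist_comm]
    rw [h2, Set.encard_coe_eq_coe_finsetCard] at h1
    exact (by exact_mod_cast h1 : _ ≤ N).trans (le_max_left _ _)
  set κ : ℝ := (c * α) ^ 2 / (16 * (max N 1 : ℕ)) with hκ
  have hκ0 : 0 < κ := by positivity
  have hρ : 1 - κ ^ 2 / (4 * (max N 1 : ℕ) ^ 2) < 1 := by
    have : 0 < κ ^ 2 / (4 * ((max N 1 : ℕ) : ℝ) ^ 2) := by positivity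
    linarith
  have hκ1 : κ ≤ 1 := by
    rw [hκ, div_le_one (by positivity)]
    have : c * α ≤ 1 := by nlinarith
    nlinarith [mul_pos hc hα]
  have hρ0 : 0 ≤ 1 - κ ^ 2 / (4 * (max N 1 : ℕ) ^ 2) := by
    rw [sub_nonneg, div_le_one (by positivity)]
    nlinarith
  obtain ⟨k, hk⟩ := exists_pow_lt_of_lt_one (half_pos hε) hρ
  refine ⟨(k + 1) * R, fun n => ?_⟩
  obtain ⟨K, hK, hKn⟩ := exists_matrix_near_averaging (m n) (hm n).1 (hm n).2 R hR.le (max N 1)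
    (le_max_right _ _) (hcard n) c α hc hc1 hα hα3 (hA n) k
  refine ⟨K, hK, fun v => ?_⟩
  have hle : ‖Matrix.toEuclideanCLM (𝕜 := ℝ) K - InnerProductSpace.rankOne ℝ
      (averagingVector (m n) Finset.univ) (averagingVector (m n) Finset.univ)‖ ≤ ε := by
    refine hKn.trans ?_
    have : (1 - κ ^ 2 / (4 * (max N 1 : ℕ) ^ 2)) ^ (k + 1)
        ≤ (1 - κ ^ 2 / (4 * (max N 1 : ℕ) ^ 2)) ^ k := pow_le_pow_of_le_one hρ0 hρ.le k.le_succ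
    linarith
  have h1 := (ContinuousLinearMap.le_opNorm _ (WithLp.toLp 2 v)).trans
    (mul_le_mul_of_nonneg_right hle (norm_nonneg _))
  have h2 := pow_le_pow_left₀ (norm_nonneg _) h1 2
  rw [mul_pow, EuclideanSpace.real_norm_sq_eq, EuclideanSpace.real_norm_sq_eq] at h2
  refine le_of_eq_of_le (Finset.sum_congr rfl fun x _ => ?_) h2
  congr 1
  simp [averagingVector, (hm n).2, PiLp.inner_apply, Matrix.mulVec, dotProduct, sub_mul,
    Finset.sum_sub_distrib, Finset.sum_mul]
  refine Finset.sum_congr rfl fun y _ => by ring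

end Approximation

/-! ### Block-diagonal operators on `ℓ²` of a sparse space -/

section BlockDiagonal

open scoped InnerProductSpace

variable {H : Type w} {Z : Type u} [MetricSpace Z]

/-- A sparse space is in bijection with the disjoint union of its blocks. -/
noncomputable def SparseDecomposition.sigmaEquiv (D : SparseDecomposition Z) :
    (Σ n, D.block n) ≃ Z :=
  Equiv.ofBijective (fun p => (p.2 : Z)) <| by
    refine ⟨?_, fun z => ?_⟩
    · rintro ⟨n, x, hx⟩ ⟨k, y, hy⟩ (rfl : x = y)
      have : n = k := by
        by_contra hne
        exact Finset.disjoint_left.1 (D.block_disjoint n k hne) hx hy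
      subst this
      rfl
    · obtain ⟨n, hn⟩ := D.block_cover z
      exact ⟨⟨n, z, hn⟩, rfl⟩

lemma SparseDecomposition.sigmaEquiv_symm_apply (D : SparseDecomposition Z) (n : ℕ)
    (x : D.block n) : D.sigmaEquiv.symm (x : Z) = ⟨n, x⟩ :=
  D.sigmaEquiv.symm_apply_apply ⟨n, x⟩

lemma SparseDecomposition.notMem_block (D : SparseDecomposition Z) {n k : ℕ} (h : n ≠ k) {z : Z}
    (hz : z ∈ D.block n) : z ∉ D.block k :=
  Finset.disjoint_left.1 (D.block_disjoint n k h) hz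

/-- The restriction of a function to a block. -/
noncomputable def blockPart (D : SparseDecomposition Z) (n : ℕ) (f : Z → H) :
    PiLp 2 (fun _ : D.block n => H) :=
  WithLp.toLp 2 fun y => f y

@[simp]
lemma blockPart_apply (D : SparseDecomposition Z) (n : ℕ) (f : Z → H) (x : D.block n) :
    blockPart D n f x = f x := rfl

variable [NormedAddCommGroup H]

lemma ext_blockPart (D : SparseDecomposition Z) {f g : L2 H Z}
    (h : ∀ n, blockPart D n f = blockPart D n g) : f = g := by
  ext z
  obtain ⟨n, hn⟩ := D.block_cover z
  exact congrArg (fun v : PiLp 2 (fun _ : D.block n => H) => v ⟨z, hn⟩) (h n)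

variable [InnerProductSpace ℂ H]

lemma hasSum_inner_blockPart (D : SparseDecomposition Z) (f g : L2 H Z) :
    HasSum (fun n => ⟪blockPart D n f, blockPart D n g⟫_ℂ) ⟪f, g⟫_ℂ := by
  have h := D.sigmaEquiv.hasSum_iff.2 (lp.hasSum_inner (𝕜 := ℂ) f g)
  refine h.sigma fun n => ?_
  rw [PiLp.inner_apply]
  exact hasSum_fintype _

lemma hasSum_norm_sq_blockPart (D : SparseDecomposition Z) (f : L2 H Z) :
    HasSum (fun n => ‖blockPart D n f‖ ^ 2) (‖f‖ ^ 2) := by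
  have h := hasSum_inner_blockPart D f f
  simp only [inner_self_eq_norm_sq_to_K] at h
  exact_mod_cast h

lemma norm_blockPart_le (D : SparseDecomposition Z) (n : ℕ) (f : L2 H Z) :
    ‖blockPart D n f‖ ≤ ‖f‖ :=
  (pow_le_pow_iff_left₀ (norm_nonneg _) (norm_nonneg _) two_ne_zero).1
    (le_hasSum (hasSum_norm_sq_blockPart D f) n fun _ _ => sq_nonneg _)

lemma norm_eq_norm_blockPart (D : SparseDecomposition Z) (n : ℕ) (f : L2 H Z)
    (hf : ∀ k, k ≠ n → blockPart D k f = 0) : ‖f‖ = ‖blockPart D n f‖ :=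
  (pow_left_inj₀ (norm_nonneg _) (norm_nonneg _) two_ne_zero).1
    ((hasSum_norm_sq_blockPart D f).unique (hasSum_single n fun k hk => by simp [hf k hk]))

lemma norm_le_of_forall_blockPart (D : SparseDecomposition Z) (f g : L2 H Z) (C : ℝ) (hC : 0 ≤ C)
    (h : ∀ n, ‖blockPart D n g‖ ≤ C * ‖blockPart D n f‖) : ‖g‖ ≤ C * ‖f‖ := by
  refine (pow_le_pow_iff_left₀ (norm_nonneg _) (by positivity) two_ne_zero).1 ?_
  rw [mul_pow]
  refine hasSum_le (fun n => ?_) (hasSum_norm_sq_blockPart D g)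
    ((hasSum_norm_sq_blockPart D f).mul_left (C ^ 2))
  rw [← mul_pow]
  exact pow_le_pow_left₀ (norm_nonneg _) (h n) 2

/-- `T` is the direct sum of the operators `F n` on the blocks. -/
def IsBlockDiagonal (D : SparseDecomposition Z) (T : L2 H Z →L[ℂ] L2 H Z)
    (F : ∀ n, PiLp 2 (fun _ : D.block n => H) →L[ℂ] PiLp 2 (fun _ : D.block n => H)) : Prop :=
  ∀ (f : L2 H Z) (n : ℕ), blockPart D n (T f) = F n (blockPart D n f)

/-- Square-summability is checked blockwise: the uniform bound `C` compares the block norms of the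
output with those of the input. -/
lemma exists_isBlockDiagonal (D : SparseDecomposition Z)
    (F : ∀ n, PiLp 2 (fun _ : D.block n => H) →L[ℂ] PiLp 2 (fun _ : D.block n => H)) (C : ℝ)
    (hC : 0 ≤ C) (hF : ∀ n v, ‖F n v‖ ≤ C * ‖v‖) :
    ∃ T : L2 H Z →L[ℂ] L2 H Z, IsBlockDiagonal D T F := by
  let g : (Z → H) → Z → H := fun f z =>
    F (D.sigmaEquiv.symm z).1 (blockPart D _ f) (D.sigmaEquiv.symm z).2
  have hg : ∀ f n, blockPart D n (g f) = F n (blockPart D n f) := fun f n => by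
    ext x
    simp only [blockPart_apply, g]
    rw [D.sigmaEquiv_symm_apply]
  have hmem : ∀ f : L2 H Z, Memℓp (g f) 2 := fun f => by
    refine memℓp_gen ?_
    simp only [ENNReal.toReal_ofNat, Real.rpow_ofNat]
    refine D.sigmaEquiv.summable_iff.1 ((summable_sigma_of_nonneg
      (f := fun p => ‖g f (D.sigmaEquiv p)‖ ^ 2) fun _ => sq_nonneg _).2
        ⟨fun n => Summable.of_finite, ?_⟩)
    refine Summable.of_nonneg_of_le (fun n => tsum_nonneg fun _ => sq_nonneg _) (fun n => ?_)
      ((hasSum_norm_sq_blockPart D f).summable.mul_left (C ^ 2))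
    rw [tsum_fintype]
    have h1 := pow_le_pow_left₀ (norm_nonneg _) (hF n (blockPart D n f)) 2
    rw [← hg, PiLp.norm_sq_eq_of_L2, mul_pow] at h1
    exact h1
  let T₀ : L2 H Z →ₗ[ℂ] L2 H Z :=
    { toFun := fun f => ⟨g f, hmem f⟩
      map_add' := fun f f' => by
        ext z
        have : blockPart D (D.sigmaEquiv.symm z).1 (⇑(f + f'))
            = blockPart D _ f + blockPart D _ f' := rfl
        change g _ z = g _ z + g _ z
        simp only [g, this, map_add]
        rfl
      map_smul' := fun c f => by
        ext z
        have : blockPart D (D.sigmaEquiv.symm z).1 (⇑(c • f)) = c • blockPart D _ f := rfl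
        change g _ z = c • g _ z
        simp only [g, this, map_smul]
        rfl }
  refine ⟨T₀.mkContinuous C fun f => norm_le_of_forall_blockPart D f _ C hC fun n => ?_,
    fun f n => hg f n⟩
  exact (congrArg norm (hg f n)).trans_le (hF n _)

lemma IsBlockDiagonal.sub_apply {D : SparseDecomposition Z} {T T' : L2 H Z →L[ℂ] L2 H Z}
    {F F' : ∀ n, PiLp 2 (fun _ : D.block n => H) →L[ℂ] PiLp 2 (fun _ : D.block n => H)}
    (hT : IsBlockDiagonal D T F) (hT' : IsBlockDiagonal D T' F') :
    IsBlockDiagonal D (T - T') fun n => F n - F' n := fun f n =>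
  congrArg₂ (· - ·) (hT f n) (hT' f n)

lemma IsBlockDiagonal.norm_le {D : SparseDecomposition Z} {T : L2 H Z →L[ℂ] L2 H Z}
    {F : ∀ n, PiLp 2 (fun _ : D.block n => H) →L[ℂ] PiLp 2 (fun _ : D.block n => H)}
    (hT : IsBlockDiagonal D T F) (C : ℝ) (hC : 0 ≤ C) (hF : ∀ n v, ‖F n v‖ ≤ C * ‖v‖) : ‖T‖ ≤ C :=
  T.opNorm_le_bound hC fun f => norm_le_of_forall_blockPart D f _ C hC fun n => by
    rw [hT]; exact hF n _

lemma IsBlockDiagonal.isStarProjection [CompleteSpace H] {D : SparseDecomposition Z}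
    {T : L2 H Z →L[ℂ] L2 H Z}
    {F : ∀ n, PiLp 2 (fun _ : D.block n => H) →L[ℂ] PiLp 2 (fun _ : D.block n => H)}
    (hT : IsBlockDiagonal D T F) (hF : ∀ n, IsStarProjection (F n)) : IsStarProjection T := by
  refine ⟨?_, ?_⟩
  · ext1 f
    refine ext_blockPart D fun n => ?_
    rw [mul_apply_eq_comp, hT, hT, ← mul_apply_eq_comp, (hF n).isIdempotentElem.eq]
  · rw [ContinuousLinearMap.isSelfAdjoint_iff_isSymmetric]
    intro f g
    have h : (fun n => ⟪blockPart D n (T f), blockPart D n g⟫_ℂ)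
        = fun n => ⟪blockPart D n f, blockPart D n (T g)⟫_ℂ := funext fun n => by
      rw [hT, hT]
      exact (hF n).isSelfAdjoint.isSymmetric _ _
    exact (hasSum_inner_blockPart D (T f) g).unique (h ▸ hasSum_inner_blockPart D f (T g))

lemma delta_apply_self {X : Type u} (y : X) (ζ : H) : delta H y ζ y = ζ := by
  classical
  exact lp.single_apply_self (E := fun _ : X => H) 2 y ζ

lemma delta_apply_ne {X : Type u} {y z : X} (h : z ≠ y) (ζ : H) : delta H y ζ z = 0 := by
  classical
  exact lp.single_apply_ne (E := fun _ : X => H) 2 y ζ h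

lemma blockPart_delta_ne (D : SparseDecomposition Z) {n k : ℕ} (h : k ≠ n) (y : D.block n) (ζ : H) :
    blockPart D k (delta H (y : Z) ζ) = 0 := by
  ext x
  exact delta_apply_ne (fun hxy => D.notMem_block h x.2 (by rw [hxy]; exact y.2)) ζ

lemma inner_blockPart_delta (D : SparseDecomposition Z) (n : ℕ) (y : D.block n) (ζ : H)
    (v : PiLp 2 (fun _ : D.block n => H)) :
    ⟪v, blockPart D n (delta H (y : Z) ζ)⟫_ℂ = ⟪v y, ζ⟫_ℂ := by
  rw [PiLp.inner_apply, Finset.sum_eq_single y]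
  · rw [blockPart_apply, delta_apply_self]
  · intro x _ hx
    rw [blockPart_apply, delta_apply_ne fun h => hx (Subtype.ext h), inner_zero_right]
  · simp

/-- The measure associated to a block-rank-one projection consists of the squared norms of the
entries of the unit vectors. -/
lemma IsBlockDiagonal.associatedMeasure_eq {D : SparseDecomposition Z} {P : L2 H Z →L[ℂ] L2 H Z}
    {ξ : ∀ n, PiLp 2 (fun _ : D.block n => H)} (hξ : ∀ n, ‖ξ n‖ = 1)
    (hP : IsBlockDiagonal D P fun n => InnerProductSpace.rankOne ℂ (ξ n) (ξ n)) (n : ℕ)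
    (x : D.block n) : associatedMeasure D P n x = ‖ξ n x‖ ^ 2 := by
  have : ‖P.comp (delta H (x : Z))‖ = ‖innerSL ℂ (ξ n x)‖ := by
    refine ContinuousLinearMap.opNorm_ext _ _ fun ζ => ?_
    rw [ContinuousLinearMap.comp_apply, norm_eq_norm_blockPart D n, hP,
      InnerProductSpace.rankOne_apply, inner_blockPart_delta, norm_smul, hξ, mul_one,
      innerSL_apply_apply]
    intro k hk
    rw [hP, blockPart_delta_ne D hk, map_zero]
  rw [associatedMeasure, this, innerSL_apply_norm]

end BlockDiagonal

/-! ### Real matrices acting on `ℓ²(V; H)` along a unit vector -/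

section MatrixOperators

open scoped InnerProductSpace

variable {H : Type w} [NormedAddCommGroup H] [InnerProductSpace ℂ H] {V : Type u}

/-- The unit vector in `ℓ²(V; H)` with entries `√(m x) e`. -/
noncomputable def sqrtVector (e : H) (m : V → ℝ) : PiLp 2 (fun _ : V => H) :=
  WithLp.toLp 2 fun x => (√(m x) : ℂ) • e

lemma norm_sqrtVector_apply_sq (e : H) (he : ‖e‖ = 1) (m : V → ℝ) (hm : ∀ x, 0 ≤ m x) (x : V) :
    ‖sqrtVector e m x‖ ^ 2 = m x := by
  simp [sqrtVector, norm_smul, he, Real.sq_sqrt (hm x)]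

variable [Fintype V]

/-- The operator `G ⊗ |e⟩⟨e|` on `ℓ²(V; H)`. -/
noncomputable def matrixOp (e : H) (G : V → V → ℝ) :
    PiLp 2 (fun _ : V => H) →L[ℂ] PiLp 2 (fun _ : V => H) :=
  (PiLp.continuousLinearEquiv 2 ℂ fun _ : V => H).symm.toContinuousLinearMap ∘L
    ContinuousLinearMap.pi fun x => ∑ y, (G x y : ℂ) •
      (InnerProductSpace.rankOne ℂ e e ∘L PiLp.proj 2 (fun _ : V => H) y)

lemma matrixOp_apply (e : H) (G : V → V → ℝ) (f : PiLp 2 (fun _ : V => H)) (x : V) :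
    matrixOp e G f x = (∑ y, (G x y : ℂ) * ⟪e, f y⟫_ℂ) • e := by
  simp only [matrixOp, Finset.sum_smul, mul_smul]
  simp

/-- As `G` is real, its bound applies separately to the real and imaginary parts of `⟪e, f y⟫`, and
`|⟪e, f y⟫| ≤ ‖f y‖`. -/
lemma norm_matrixOp_apply_le (e : H) (he : ‖e‖ = 1) (G : V → V → ℝ) (C : ℝ) (hC : 0 ≤ C)
    (hG : ∀ v : V → ℝ, ∑ x, (∑ y, G x y * v y) ^ 2 ≤ C ^ 2 * ∑ x, v x ^ 2)
    (f : PiLp 2 (fun _ : V => H)) : ‖matrixOp e G f‖ ≤ C * ‖f‖ := by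
  refine (pow_le_pow_iff_left₀ (norm_nonneg _) (by positivity) two_ne_zero).1 ?_
  rw [mul_pow, PiLp.norm_sq_eq_of_L2, PiLp.norm_sq_eq_of_L2]
  have h1 : ∀ x, ‖matrixOp e G f x‖ ^ 2
      = (∑ y, G x y * (⟪e, f y⟫_ℂ).re) ^ 2 + (∑ y, G x y * (⟪e, f y⟫_ℂ).im) ^ 2 := fun x => by
    rw [matrixOp_apply, norm_smul, he, mul_one, Complex.sq_norm, Complex.normSq_apply]
    simp [sq]
  have h2 : ∀ y, (⟪e, f y⟫_ℂ).re ^ 2 + (⟪e, f y⟫_ℂ).im ^ 2 ≤ ‖f y‖ ^ 2 := fun y => by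
    have h3 := norm_inner_le_norm (𝕜 := ℂ) e (f y)
    rw [he, one_mul] at h3
    calc _ = ‖⟪e, f y⟫_ℂ‖ ^ 2 := by rw [Complex.sq_norm, Complex.normSq_apply]; ring
      _ ≤ _ := pow_le_pow_left₀ (norm_nonneg _) h3 2
  simp only [h1, Finset.sum_add_distrib]
  refine (add_le_add (hG _) (hG _)).trans ?_
  rw [← mul_add, ← Finset.sum_add_distrib]
  exact mul_le_mul_of_nonneg_left (Finset.sum_le_sum fun y _ => h2 y) (sq_nonneg _)

lemma norm_sqrtVector (e : H) (he : ‖e‖ = 1) (m : V → ℝ) (hm : m ∈ stdSimplex ℝ V) :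
    ‖sqrtVector e m‖ = 1 := by
  rw [← pow_eq_one_iff_of_nonneg (norm_nonneg _) two_ne_zero, PiLp.norm_sq_eq_of_L2]
  simp only [norm_sqrtVector_apply_sq e he m hm.1, hm.2]

lemma matrixOp_sub_rankOne_sqrtVector (e : H) (m : V → ℝ) (K : V → V → ℝ) :
    matrixOp e K - InnerProductSpace.rankOne ℂ (sqrtVector e m) (sqrtVector e m)
      = matrixOp e fun x y => K x y - √(m x) * √(m y) := by
  ext f x
  have h : ⟪sqrtVector e m, f⟫_ℂ = ∑ y, (√(m y) : ℂ) * ⟪e, f y⟫_ℂ := by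
    rw [PiLp.inner_apply]
    refine Finset.sum_congr rfl fun y _ => ?_
    simp only [sqrtVector]
    rw [inner_smul_left, Complex.conj_ofReal]
  have h2 : (InnerProductSpace.rankOne ℂ (sqrtVector e m) (sqrtVector e m) f) x
      = (∑ y, ((√(m x) * √(m y) : ℝ) : ℂ) * ⟪e, f y⟫_ℂ) • e := by
    rw [InnerProductSpace.rankOne_apply, h]
    simp only [sqrtVector, PiLp.smul_apply, smul_smul, Complex.ofReal_mul, Finset.sum_mul]
    congr 1
    exact Finset.sum_congr rfl fun y _ => by ring
  rw [_root_.sub_apply, PiLp.sub_apply, matrixOp_apply, matrixOp_apply, h2, ← sub_smul,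
    ← Finset.sum_sub_distrib]
  congr 1
  exact Finset.sum_congr rfl fun y _ => by push_cast; ring

end MatrixOperators

/-! ### Ghost projections versus measured asymptotic expanders -/

section RoeAlgebras

open scoped InnerProductSpace

variable {H : Type w} [NormedAddCommGroup H] [InnerProductSpace ℂ H] {Z : Type u} [MetricSpace Z]

lemma isCompactOperator_rankOne (e e' : H) : IsCompactOperator (InnerProductSpace.rankOne ℂ e e') := by
  have h : IsCompactOperator (id : ℂ → ℂ) :=
    (isCompactOperator_id_iff_finiteDimensional (𝕜 := ℂ)).2 inferInstance
  exact (h.clm_comp (ContinuousLinearMap.toSpanSingleton ℂ e)).comp_clm (innerSL ℂ e')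

/-- Yields finite propagation and local compactness together, since every entry is a multiple of one
rank-one operator. -/
lemma IsBlockDiagonal.exists_entry_eq {D : SparseDecomposition Z} {T : L2 H Z →L[ℂ] L2 H Z} {e : H}
    {K : ∀ n, D.block n → D.block n → ℝ} (hT : IsBlockDiagonal D T fun n => matrixOp e (K n)) (R : ℝ)
    (hK : ∀ n x y, K n x y ≠ 0 → dist x y ≤ R) (x y : Z) :
    ∃ c : ℂ, entry T x y = c • InnerProductSpace.rankOne ℂ e e ∧ (c ≠ 0 → dist x y ≤ R) := by
  obtain ⟨n, hx⟩ := D.block_cover x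
  have happ : ∀ ζ, entry T x y ζ
      = (∑ z, (K n ⟨x, hx⟩ z : ℂ) * ⟪e, delta H y ζ (z : Z)⟫_ℂ) • e := fun ζ => by
    have h1 : entry T x y ζ = blockPart D n (T (delta H y ζ)) ⟨x, hx⟩ := rfl
    rw [h1, hT, matrixOp_apply]
    rfl
  by_cases hy : y ∈ D.block n
  · refine ⟨K n ⟨x, hx⟩ ⟨y, hy⟩, ?_, fun h => hK n ⟨x, hx⟩ ⟨y, hy⟩ (by exact_mod_cast h)⟩
    ext ζ
    rw [happ, Finset.sum_eq_single ⟨y, hy⟩]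
    · simp only [delta_apply_self]
      rw [_root_.smul_apply, InnerProductSpace.rankOne_apply, smul_smul]
    · intro z _ hz
      rw [delta_apply_ne fun h => hz (Subtype.ext h), inner_zero_right, mul_zero]
    · simp
  · refine ⟨0, ?_, fun h => absurd rfl h⟩
    ext ζ
    rw [happ, Finset.sum_eq_zero]
    · simp
    · intro z _
      rw [delta_apply_ne fun h => hy (by rw [← h]; exact z.2), inner_zero_right, mul_zero]

lemma finrank_range_rankOne_self {E : Type*} [NormedAddCommGroup E] [InnerProductSpace ℂ E] (ξ : E)
    (hξ : ‖ξ‖ = 1) :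
    Module.finrank ℂ (LinearMap.range (InnerProductSpace.rankOne ℂ ξ ξ).toLinearMap) = 1 := by
  have hne : ξ ≠ 0 := fun h => by simp [h] at hξ
  have : LinearMap.range (InnerProductSpace.rankOne ℂ ξ ξ).toLinearMap = ℂ ∙ ξ := by
    ext v
    rw [LinearMap.mem_range, Submodule.mem_span_singleton]
    constructor
    · rintro ⟨u, rfl⟩
      exact ⟨_, rfl⟩
    · rintro ⟨c, rfl⟩
      refine ⟨c • ξ, ?_⟩
      simp [inner_self_eq_norm_sq_to_K, hξ]
  rw [this, finrank_span_singleton hne]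

/-- The averaging projection of a ghostly sequence of measured asymptotic expanders is a
block-rank-one ghost projection in the Roe algebra, for every coefficient space `H ≠ 0`. -/
theorem exists_ghostProjection_mem_roeAlgebra [CompleteSpace H] (hZ : BoundedGeometry Z)
    (h : ConsistsOfGhostlyMAE Z) (e : H) (he : ‖e‖ = 1) :
    ∃ P ∈ roeAlgebra H Z, IsBlockRankOneGhostProjection P := by
  obtain ⟨D, m, hm, hghost, hmae⟩ := h
  have hξ : ∀ n, ‖sqrtVector e (m n)‖ = 1 := fun n => norm_sqrtVector e he _ (hm n)
  obtain ⟨P, hP⟩ := exists_isBlockDiagonal D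
    (fun n => InnerProductSpace.rankOne ℂ (sqrtVector e (m n)) (sqrtVector e (m n))) 1 zero_le_one
    fun n v => by
      refine (ContinuousLinearMap.le_opNorm _ v).trans ?_
      rw [InnerProductSpace.norm_rankOne, hξ, one_mul]
  refine ⟨P, ?_, D, ⟨?_, fun n => InnerProductSpace.rankOne ℂ (sqrtVector e (m n))
    (sqrtVector e (m n)), fun n => ⟨?_, finrank_range_rankOne_self _ (hξ n)⟩, fun f n x => ?_⟩, ?_⟩
  · refine Metric.mem_closure_iff.2 fun ε hε => ?_
    obtain ⟨R, hR⟩ := hmae.exists_matrix_near _ m (hZ.uniformlyBoundedGeometry D) hm (ε / 2)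
      (half_pos hε)
    choose K hKR hK using hR
    have hbd : ∀ n v, ‖(matrixOp e (K n) - InnerProductSpace.rankOne ℂ (sqrtVector e (m n))
        (sqrtVector e (m n))) v‖ ≤ ε / 2 * ‖v‖ := fun n v => by
      rw [matrixOp_sub_rankOne_sqrtVector]
      exact norm_matrixOp_apply_le e he _ _ (half_pos hε).le (hK n) v
    obtain ⟨T, hT⟩ := exists_isBlockDiagonal D (fun n => matrixOp e (K n)) (ε / 2 + 1)
      (by positivity) fun n v => by
        have h1 : matrixOp e (K n) v = (matrixOp e (K n) - InnerProductSpace.rankOne ℂ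
          (sqrtVector e (m n)) (sqrtVector e (m n))) v + InnerProductSpace.rankOne ℂ
          (sqrtVector e (m n)) (sqrtVector e (m n)) v := by
          rw [_root_.sub_apply, sub_add_cancel]
        rw [h1, add_mul]
        refine (norm_add_le _ _).trans (add_le_add (hbd n v) ?_)
        refine (ContinuousLinearMap.le_opNorm _ v).trans ?_
        rw [InnerProductSpace.norm_rankOne, hξ, one_mul]
    refine ⟨T, ⟨⟨R, fun x y hxy => ?_⟩, fun x y => ?_⟩, ?_⟩
    · obtain ⟨c, hc, hcR⟩ := hT.exists_entry_eq R hKR x y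
      refine hcR fun h0 => hxy ?_
      rw [hc, h0, zero_smul]
    · obtain ⟨c, hc, -⟩ := hT.exists_entry_eq R hKR x y
      rw [hc]
      exact (isCompactOperator_rankOne e e).smul c
    · rw [dist_comm, dist_eq_norm]
      exact ((hT.sub_apply hP).norm_le _ (half_pos hε).le hbd).trans_lt (half_lt_self hε)
  · exact hP.isStarProjection fun n => InnerProductSpace.isStarProjection_rankOne_self (hξ n)
  · exact InnerProductSpace.isStarProjection_rankOne_self (hξ n)
  · exact congrArg (fun v : PiLp 2 (fun _ : D.block n => H) => v x) (hP f n)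
  · have h : associatedMeasure D P = m := by
      funext n x
      rw [hP.associatedMeasure_eq hξ, norm_sqrtVector_apply_sq e he _ (hm n).1]
    rw [h]
    exact hghost

/-- A rank-one projection is given by a unit vector. -/
lemma exists_eq_rankOne_of_isStarProjection {E : Type*} [NormedAddCommGroup E]
    [InnerProductSpace ℂ E] [CompleteSpace E] (Q : E →L[ℂ] E) (hQ : IsStarProjection Q)
    (h1 : Module.finrank ℂ (LinearMap.range Q.toLinearMap) = 1) :
    ∃ ξ : E, ‖ξ‖ = 1 ∧ Q = InnerProductSpace.rankOne ℂ ξ ξ := by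
  obtain ⟨⟨η, hη⟩, hη0, hspan⟩ := finrank_eq_one_iff'.1 h1
  have hne : η ≠ 0 := fun h => hη0 (Subtype.ext h)
  have hQη : Q η = η := by
    obtain ⟨u, rfl⟩ := hη
    change Q (Q u) = Q u
    rw [← mul_apply_eq_comp, hQ.isIdempotentElem.eq]
  set ξ : E := ((‖η‖⁻¹ : ℝ) : ℂ) • η with hξ
  have hξ1 : ‖ξ‖ = 1 := by
    rw [hξ, norm_smul, Complex.norm_real, norm_inv, norm_norm, inv_mul_cancel₀ (norm_ne_zero_iff.2 hne)]
  have hQξ : Q ξ = ξ := by rw [hξ, map_smul, hQη]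
  refine ⟨ξ, hξ1, ?_⟩
  ext v
  obtain ⟨c, hc⟩ := hspan ⟨Q v, v, rfl⟩
  have hc' : Q v = c • η := (congrArg Subtype.val hc).symm
  have hηξ : η = (‖η‖ : ℂ) • ξ := by
    rw [hξ, smul_smul, ← Complex.ofReal_mul, mul_inv_cancel₀ (norm_ne_zero_iff.2 hne),
      Complex.ofReal_one, one_smul]
  have h2 : Q v = (c * ‖η‖) • ξ := by rw [hc', mul_smul, ← hηξ]
  have h3 : ⟪ξ, v⟫_ℂ = c * ‖η‖ := by
    have h4 : ⟪Q ξ, v⟫_ℂ = ⟪ξ, Q v⟫_ℂ := hQ.isSelfAdjoint.isSymmetric ξ v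
    rw [hQξ, h2, inner_smul_right, inner_self_eq_norm_sq_to_K, hξ1] at h4
    simpa using h4
  rw [InnerProductSpace.rankOne_apply, h3, h2]

/-- A block-rank-one ghost projection in the closure of the operators of finite propagation comes
from a ghostly sequence of measured asymptotic expanders. -/
theorem consistsOfGhostlyMAE_of_ghostProjection [CompleteSpace H] (P : L2 H Z →L[ℂ] L2 H Z)
    (hPc : P ∈ closure {T : L2 H Z →L[ℂ] L2 H Z | FinitePropagation T})
    (hP : IsBlockRankOneGhostProjection P) : ConsistsOfGhostlyMAE Z := by
  classical
  obtain ⟨D, ⟨-, Q, hQ, hPQ⟩, hghost⟩ := hP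
  choose ξ hξ hQξ using fun n => exists_eq_rankOne_of_isStarProjection (Q n) (hQ n).1 (hQ n).2
  have hdiag : IsBlockDiagonal D P fun n => InnerProductSpace.rankOne ℂ (ξ n) (ξ n) :=
    fun f n => by
      ext x
      change _ = InnerProductSpace.rankOne ℂ (ξ n) (ξ n) (blockPart D n f) x
      rw [← hQξ]
      exact hPQ f n x
  have hmeas : ∀ n x, associatedMeasure D P n x = ‖ξ n x‖ ^ 2 := hdiag.associatedMeasure_eq hξ
  have htot : ∀ n, ∑ x, associatedMeasure D P n x = 1 := fun n => by
    simp only [hmeas]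
    rw [← PiLp.norm_sq_eq_of_L2, hξ, one_pow]
  have hnn : ∀ n x, 0 ≤ associatedMeasure D P n x := fun n x => sq_nonneg _
  refine ⟨D, associatedMeasure D P, fun n => ⟨hnn n, htot n⟩, hghost, fun α hα hα2 => ?_⟩
  -- Any squared error below `α/4` would do; see the final contradiction.
  obtain ⟨T, ⟨R, hR⟩, hPT⟩ := Metric.mem_closure_iff.1 hPc √(α / 8) (by positivity)
  refine ⟨1 / 2, by norm_num, by norm_num, max R 1, by positivity, fun n A hA1 hA2 => ?_⟩
  by_contra! hcon
  set μ : Finset (D.block n) → ℝ := fun A => ∑ x ∈ A, associatedMeasure D P n x with hμ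
  -- If expansion fails, `A` and its boundary have mass at most `1/2 + 1/4`, leaving at least `1/4`
  -- for `B`.
  set B := (A ∪ outerBoundary (max R 1) A)ᶜ with hB
  have hBm : 1 / 4 ≤ μ B := by
    have h1 := Finset.sum_compl_add_sum (A ∪ outerBoundary (max R 1) A) (associatedMeasure D P n)
    have h2 := Finset.sum_union_inter (s₁ := A) (s₂ := outerBoundary (max R 1) A)
      (f := associatedMeasure D P n)
    have h3 : 0 ≤ ∑ x ∈ A ∩ outerBoundary (max R 1) A, associatedMeasure D P n x :=
      Finset.sum_nonneg fun x _ => hnn n x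
    rw [htot] at h1
    simp only [hμ, hB]
    linarith
  set f : L2 H Z := ∑ y ∈ B, delta H (y : Z) (ξ n y) with hf
  have hfapp : ∀ z, f z = ∑ y ∈ B, delta H (y : Z) (ξ n y) z := fun z => by
    rw [hf, lp.coeFn_sum, Finset.sum_apply]
  have hfn : ∀ x : D.block n, f x = if x ∈ B then ξ n x else 0 := fun x => by
    rw [hfapp]
    split_ifs with hx
    · rw [Finset.sum_eq_single_of_mem x hx, delta_apply_self]
      intro y _ hy
      exact delta_apply_ne (fun h => hy (Subtype.ext h.symm)) _
    · refine Finset.sum_eq_zero fun y hy => delta_apply_ne (fun h => hx ?_) _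
      rwa [Subtype.ext h]
  have hfk : ∀ k, k ≠ n → blockPart D k f = 0 := fun k hk => by
    ext x
    rw [blockPart_apply, hfapp]
    exact Finset.sum_eq_zero fun y _ =>
      delta_apply_ne (fun h => D.notMem_block hk x.2 (by rw [h]; exact y.2)) _
  have hfnorm : ‖f‖ ^ 2 = μ B := by
    rw [norm_eq_norm_blockPart D n f hfk, PiLp.norm_sq_eq_of_L2]
    simp only [blockPart_apply, hfn, hμ, hmeas]
    rw [← Finset.sum_subset (Finset.subset_univ B)]
    · exact Finset.sum_congr rfl fun x hx => by rw [if_pos hx]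
    · intro x _ hx
      simp [hx]
  have hinner : ⟪ξ n, blockPart D n f⟫_ℂ = (μ B : ℂ) := by
    rw [PiLp.inner_apply]
    simp only [blockPart_apply, hfn, hμ, hmeas]
    rw [← Finset.sum_subset (Finset.subset_univ B), Complex.ofReal_sum]
    · refine Finset.sum_congr rfl fun x hx => ?_
      rw [if_pos hx, inner_self_eq_norm_sq_to_K]
      norm_cast
    · intro x _ hx
      simp [hx]
  have hTf : ∀ x ∈ A, T f (x : Z) = 0 := fun x hx => by
    have h1 : T f (x : Z) = ∑ y ∈ B, entry T (x : Z) y (ξ n y) := by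
      rw [hf, map_sum, lp.coeFn_sum, Finset.sum_apply]
      rfl
    rw [h1]
    refine Finset.sum_eq_zero fun y hy => ?_
    have hy' : y ∉ A ∪ outerBoundary (max R 1) A := Finset.mem_compl.1 hy
    rw [Finset.mem_union, not_or, mem_outerBoundary] at hy'
    have h0 : entry T (x : Z) y = 0 := by
      by_contra hne
      refine hy'.2 ⟨hy'.1, x, hx, ?_⟩
      rw [dist_comm]
      exact (hR _ _ hne).trans (le_max_left _ _)
    rw [h0, _root_.zero_apply]
  have hPf : ∀ x ∈ A, blockPart D n ((P - T) f) x = (μ B : ℂ) • ξ n x := fun x hx => by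
    have h1 : blockPart D n ((P - T) f) x = blockPart D n (P f) x - T f (x : Z) := rfl
    rw [h1, hTf x hx, sub_zero, hdiag, InnerProductSpace.rankOne_apply, hinner, PiLp.smul_apply]
  have hlow : μ B ^ 2 * μ A ≤ ‖(P - T) f‖ ^ 2 := by
    refine le_trans ?_ (pow_le_pow_left₀ (norm_nonneg _) (norm_blockPart_le D n ((P - T) f)) 2)
    rw [PiLp.norm_sq_eq_of_L2]
    refine le_trans (le_of_eq ?_) (Finset.sum_le_sum_of_subset_of_nonneg (Finset.subset_univ A)
      fun x _ _ => sq_nonneg _)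
    simp only [hμ]
    rw [Finset.mul_sum]
    refine Finset.sum_congr rfl fun x hx => ?_
    rw [hPf x hx, norm_smul, mul_pow, hmeas, Complex.norm_real, Real.norm_eq_abs, sq_abs]
  have hup : ‖(P - T) f‖ ^ 2 ≤ α / 8 * μ B := by
    rw [← hfnorm, ← Real.sq_sqrt (by positivity : 0 ≤ α / 8), ← mul_pow]
    rw [dist_eq_norm] at hPT
    exact pow_le_pow_left₀ (norm_nonneg _) ((P - T).le_of_opNorm_le hPT.le f) 2
  have hA1' : α ≤ μ A := hA1
  -- The two bounds give `μ(B)² α ≤ (α/8) μ(B)`, so `μ(B) ≤ 1/8`, against `μ(B) ≥ 1/4`.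
  nlinarith [mul_le_mul_of_nonneg_left hA1' (by linarith : 0 ≤ μ B)]

end RoeAlgebras

/-! ### The equivalences with property (3) -/

section MainEquivalences

variable {X : Type u} [MetricSpace X]

lemma noGhostInRoeAlgebras_iff (H : Type w) [NormedAddCommGroup H] [InnerProductSpace ℂ H]
    [CompleteSpace H] [Nontrivial H] (hX : BoundedGeometry X) :
    NoGhostInRoeAlgebras H X ↔ ContainsNoGhostlyMAE X := by
  constructor
  · intro h S hS
    obtain ⟨e, he⟩ := exists_norm_eq H zero_le_one
    obtain ⟨P, hP, hghost⟩ := exists_ghostProjection_mem_roeAlgebra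
      (hX.of_isometry isometry_subtype_coe) hS e he
    obtain ⟨D, -⟩ := hS
    exact h S ⟨D⟩ P hP hghost
  · intro h S _ P hP hghost
    exact h S (consistsOfGhostlyMAE_of_ghostProjection P (closure_mono (fun _ hT => hT.1) hP) hghost)

/-- The Roe algebra with coefficients `ℂ` lies in the uniform Roe algebra, so the construction for
general coefficients already yields the uniform case. -/
lemma noGhostInUniformRoeAlgebras_iff (hX : BoundedGeometry X) :
    NoGhostInUniformRoeAlgebras X ↔ ContainsNoGhostlyMAE X := by
  constructor
  · intro h
    refine (noGhostInRoeAlgebras_iff ℂ hX).1 fun S hS P hP => ?_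
    exact h S hS P (closure_mono (fun _ hT => hT.1) hP)
  · intro h S _ P hP hghost
    exact h S (consistsOfGhostlyMAE_of_ghostProjection P hP hghost)

end MainEquivalences

end RoeRigidity

theorem mainTheorem3
    (H : Type w) [NormedAddCommGroup H] [InnerProductSpace ℂ H] [CompleteSpace H]
    [TopologicalSpace.SeparableSpace H] (hH : ¬ FiniteDimensional ℂ H)
    (X : Type u) [MetricSpace X] (hX : RoeRigidity.BoundedGeometry X) :
    [RoeRigidity.NoGhostInRoeAlgebras H X,
      RoeRigidity.NoGhostInUniformRoeAlgebras X,
      RoeRigidity.ContainsNoGhostlyMAE X,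
      RoeRigidity.CoarselyContainsNoGhostlyMAE.{u, v} X].TFAE ∧
    ∀ (Y : Type t) [MetricSpace Y], RoeRigidity.BoundedGeometry Y →
      RoeRigidity.CoarselyEquivalent X Y →
      (RoeRigidity.NoGhostInRoeAlgebras H X ↔ RoeRigidity.NoGhostInRoeAlgebras H Y) ∧
      (RoeRigidity.NoGhostInUniformRoeAlgebras X ↔ RoeRigidity.NoGhostInUniformRoeAlgebras Y) ∧
      (RoeRigidity.ContainsNoGhostlyMAE X ↔ RoeRigidity.ContainsNoGhostlyMAE Y) ∧
      (RoeRigidity.CoarselyContainsNoGhostlyMAE.{u, v} X ↔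
        RoeRigidity.CoarselyContainsNoGhostlyMAE.{t, v} Y) := by
  have hnt : Nontrivial H := by
    by_contra h
    rw [not_nontrivial_iff_subsingleton] at h
    exact hH inferInstance
  refine ⟨?_, fun Y _ hY hXY => ?_⟩
  · tfae_have 1 ↔ 3 := RoeRigidity.noGhostInRoeAlgebras_iff H hX
    tfae_have 2 ↔ 3 := RoeRigidity.noGhostInUniformRoeAlgebras_iff hX
    tfae_have 3 ↔ 4 := RoeRigidity.containsNoGhostlyMAE_iff hX
    tfae_finish
  -- Invariance is proved for (4), by composing embeddings, and carried to the others through the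
  -- equivalences.
  · have h4 : RoeRigidity.CoarselyContainsNoGhostlyMAE.{u, v} X ↔
        RoeRigidity.CoarselyContainsNoGhostlyMAE.{t, v} Y := by
      obtain ⟨g, hg⟩ := hXY.exists_isCoarseEmbedding_symm
      obtain ⟨f, hf, -⟩ := hXY
      exact ⟨.of_isCoarseEmbedding hg, .of_isCoarseEmbedding hf⟩
    have h3 : RoeRigidity.ContainsNoGhostlyMAE X ↔ RoeRigidity.ContainsNoGhostlyMAE Y := by
      rw [RoeRigidity.containsNoGhostlyMAE_iff.{u, v} hX,
        RoeRigidity.containsNoGhostlyMAE_iff.{t, v} hY, h4]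
    refine ⟨?_, ?_, h3, h4⟩
    · rw [RoeRigidity.noGhostInRoeAlgebras_iff H hX, RoeRigidity.noGhostInRoeAlgebras_iff H hY, h3]
    · rw [RoeRigidity.noGhostInUniformRoeAlgebras_iff hX,
        RoeRigidity.noGhostInUniformRoeAlgebras_iff hY, h3]
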